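/- Let $e=\prod_p p^{n_p}$, $n_p\in\{0,1,2,\dots,\infty\}$, be a Steinitz number. A positive integer $d$ divides $e$ if $\operatorname{ord}_p(d)\le n_p$ for all primes $p$; a group is $e$-torsion if each of its elements has finite order dividing $e$. Let $\mu_e$ be the $e$-torsion subgroup of the circle group $\mathbb T\subset\mathbb C^*$, and let $\hat{\mathbb Z}/e\hat{\mathbb Z}=\varprojlim_{d\mid e}\mathbb Z/d\mathbb Z$, which acts on $\mu_e$ by exponentiation; for a unit $a$ of this ring, $\zeta\mapsto\zeta^a$ extends uniquely to an automorphism of the ring $\mathbb Z[\mu_e]\subset\mathbb C$. Let $k$ be a commutative ring and $R$ a (not necessarily commutative) $k$-algebra on which multiplication by every positive integer dividing $e$ is injective. Put $k'=k\otimes_{\mathbb Z}\mathbb Z[\mu_e]$, $R'=R\otimes_{\mathbb Z}\mathbb Z[\mu_e]$ and $A=\operatorname{Aut}_{k'\text{-Alg}}(R')$, with the compact-open topology for the discrete topology on $R'$ (that is, the topology of pointwise convergence). For $a\in(\hat{\mathbb Z}/e\hat{\mathbb Z})^*$ let $\tau_a$ be the automorphism of $R'$ induced by the one of $\mathbb Z[\mu_e]$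 above. For $\sigma\in A$ and $\zeta\in\mu_e$ put $R'(\sigma,\zeta)=\{x\in R':\sigma(x)=\zeta x\}$ and $R(\sigma,\zeta)=\{x\in R:\sigma(x\otimes 1)=x\otimes\zeta\}$. Call $\sigma$ $\mu_e$-diagonalizable if $R'=\bigoplus_{\zeta\in\mu_e}R'(\sigma,\zeta)$; in that case $\sigma^a$ denotes the $k'$-linear map that acts on $R'(\sigma,\zeta)$ as multiplication by $\zeta^a$. Let $$X_e(R)=\{\sigma\in A:\ \sigma\text{ is }\mu_e\text{-diagonalizable and }\tau_a\sigma\tau_a^{-1}=\sigma^a\text{ for all }a\in(\hat{\mathbb Z}/e\hat{\mathbb Z})^*\}.$$ A grading of $R$ by a group $\Gamma$ is a family $(R_\gamma)_{\gamma\in\Gamma}$ of $k$-submodules with $R=\bigoplus_\gamma R_\gamma$, $1\in R_1$ and $R_\gamma R_\delta\subseteq R_{\gamma\delta}$ for all $\gamma,\delta\in\Gamma$. A morphism from a $\Gamma$-grading $(R_\gamma)_\gamma$ to a $\Delta$-grading $(S_\delta)_\delta$ of $R$ is a group homomorphism $\varphi:\Gamma\to\Delta$ with $S_\delta=\sum_{\varphi(\gamma)=\delta}R_\gamma$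 for all $\delta\in\Delta$. A universal abelian $e$-torsion grading of $R$ is an initial object in the category of gradings of $R$ by abelian $e$-torsion groups. **Theorem.** $R$ has a universal abelian $e$-torsion grading if and only if $X_e(R)$ is a compact abelian group, that is, $X_e(R)$ is a commutative subgroup of $A$ and is compact in the topology of $A$. If these equivalent conditions hold, let $\Delta=X_e(R)$ and let $\widehat\Delta$ be the group of continuous homomorphisms $\Delta\to\mathbb T$. Then every $\chi\in\widehat\Delta$ takes values in $\mu_e$, and the family $(R_\chi)_{\chi\in\widehat\Delta}$ with $$R_\chi=\bigcap_{\delta\in\Delta}R(\delta,\chi(\delta))$$ is a universal abelian $e$-torsion grading of $R$. -/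

import Mathlib

open scoped TensorProduct

universe w r s t

noncomputable section

/-! ### Steinitz numbers, `e`-torsion and roots of unity -/

/-- A Steinitz number `∏ p ^ (n p)` with exponents `n p ∈ {0, 1, 2, …, ∞}`. -/
abbrev Steinitz : Type := Nat.Primes → ℕ∞

/-- The positive integer `d` divides the Steinitz number `e`. -/
def StDvd (d : ℕ) (e : Steinitz) : Prop :=
  d ≠ 0 ∧ ∀ p : Nat.Primes, (padicValNat p d : ℕ∞) ≤ e p

theorem StDvd.one (e : Steinitz) : StDvd 1 e := ⟨one_ne_zero, fun p => by simp⟩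

theorem StDvd.of_dvd {c d : ℕ} {e : Steinitz} (hd : StDvd d e) (h : c ∣ d) : StDvd c e := by
  refine ⟨fun hc => hd.1 (by simpa [hc] using h), fun p => le_trans ?_ (hd.2 p)⟩
  have : Fact (p : ℕ).Prime := ⟨p.2⟩
  exact_mod_cast (padicValNat_dvd_iff_le hd.1).1 (pow_padicValNat_dvd.trans h)

theorem StDvd.lcm {c d : ℕ} {e : Steinitz} (hc : StDvd c e) (hd : StDvd d e) :
    StDvd (Nat.lcm c d) e := by
  refine ⟨Nat.lcm_ne_zero hc.1 hd.1, fun p => ?_⟩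
  have h : padicValNat p (Nat.lcm c d) = max (padicValNat p c) (padicValNat p d) := by
    simp only [← Nat.factorization_def _ p.2, Nat.factorization_lcm hc.1 hd.1, Finsupp.sup_apply]
  rw [h]
  rcases max_choice (padicValNat p c) (padicValNat p d) with h' | h' <;> rw [h']
  exacts [hc.2 p, hd.2 p]

/-- Every element of the group has finite order, and that order divides `e`. -/
def IsSteinitzTorsion (e : Steinitz) (Γ : Type*) [Group Γ] : Prop :=
  ∀ γ : Γ, StDvd (orderOf γ) e

/-- `μ_e`, the `e`-torsion subgroup of the circle group. -/
def mu (e : Steinitz) : Subgroup Circle where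
  carrier := {z | StDvd (orderOf z) e}
  one_mem' := by simpa using StDvd.one e
  mul_mem' := fun {x y} hx hy =>
    (StDvd.lcm hx hy).of_dvd (Commute.all x y).orderOf_mul_dvd_lcm
  inv_mem' := fun {x} hx => by simpa using hx

/-- The ring `ℤ[μ_e]`, as a subring of `ℂ`. -/
abbrev Zmu (e : Steinitz) : Subalgebra ℤ ℂ :=
  Algebra.adjoin ℤ {z : ℂ | ∃ ζ : mu e, ((ζ : Circle) : ℂ) = z}

/-- An element of `μ_e`, viewed in `ℤ[μ_e]`. -/
def muToZmu {e : Steinitz} (ζ : mu e) : Zmu e :=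
  ⟨((ζ : Circle) : ℂ), Algebra.subset_adjoin ⟨ζ, rfl⟩⟩

/-- The ring `ℤ̂ / e ℤ̂`, as the inverse limit of the rings `ℤ / d ℤ` over the positive integers
`d` dividing `e`. -/
def ZHatMod (e : Steinitz) : Subring (∀ d : {d : ℕ // StDvd d e}, ZMod d.1) where
  carrier := {a | ∀ (c d : {d : ℕ // StDvd d e}) (h : c.1 ∣ d.1),
    ZMod.castHom h (ZMod c.1) (a d) = a c}
  one_mem' := fun c d h => by simp only [Pi.one_apply, map_one]
  zero_mem' := fun c d h => by simp only [Pi.zero_apply, map_zero]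
  mul_mem' := fun {x y} hx hy c d h => by
    simp only [Pi.mul_apply, map_mul, hx c d h, hy c d h]
  add_mem' := fun {x y} hx hy c d h => by
    simp only [Pi.add_apply, map_add, hx c d h, hy c d h]
  neg_mem' := fun {x} hx c d h => by
    simp only [Pi.neg_apply, map_neg, hx c d h]

/-- The power `ζ ^ a` for `ζ ∈ μ_e` and `a ∈ ℤ̂ / e ℤ̂`: it is `ζ ^ n` for any integer `n` that is
congruent to `a` modulo the order of `ζ`. -/
def muPow {e : Steinitz} (ζ : mu e) (a : ZHatMod e) : mu e :=
  ζ ^ (a.1 ⟨orderOf (ζ : Circle), ζ.2⟩).val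

/-! ### Gradings -/

section Grading

variable {k : Type*} [CommRing k] {R : Type*} [Ring R] [Algebra k R]

open Classical in
/-- `𝒜` is a grading of the `k`-algebra `R` with group `Γ`. Components may be zero. -/
structure IsGroupGrading {Γ : Type*} [Group Γ] (𝒜 : Γ → Submodule k R) : Prop where
  decomposition : DirectSum.IsInternal 𝒜
  one_mem : (1 : R) ∈ 𝒜 1
  mul_mem : ∀ ⦃g h : Γ⦄ ⦃x y : R⦄, x ∈ 𝒜 g → y ∈ 𝒜 h → x * y ∈ 𝒜 (g * h)

/-- The push-forward `φ_* 𝒜`, whose component at `h` is `∑_{φ g = h} 𝒜 g`. -/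
def gradingMap {Γ Γ' : Type*} (φ : Γ → Γ') (𝒜 : Γ → Submodule k R) : Γ' → Submodule k R :=
  fun h => ⨆ (g : Γ) (_ : φ g = h), 𝒜 g

/-- `𝒰` is a universal abelian `e`-torsion grading of `R`: it is a grading by an abelian `e`-torsion
group, and it has exactly one morphism to every grading of `R` by an abelian `e`-torsion group
(in the universe `w`). A morphism of gradings is a homomorphism of the groups that pushes the first
grading forward to the second. -/
structure IsUniversalGrading {k : Type s} [CommRing k] {R : Type r} [Ring R]
    [Algebra k R] (e : Steinitz) {Υ : Type t} [CommGroup Υ] (𝒰 : Υ → Submodule k R) : Prop where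
  grading : IsGroupGrading 𝒰
  torsion : IsSteinitzTorsion e Υ
  initial : ∀ (Γ : Type w) [CommGroup Γ], IsSteinitzTorsion e Γ →
    ∀ 𝒜 : Γ → Submodule k R, IsGroupGrading 𝒜 → ∃! φ : Υ →* Γ, gradingMap φ 𝒰 = 𝒜

end Grading

/-! ### The set `X_e(R)` -/

section Ext

variable (e : Steinitz)

/-- The base extension `S' = S ⊗_ℤ ℤ[μ_e]` of a ring `S`. -/
def ExtMu (S : Type*) [Ring S] : Type _ := S ⊗[ℤ] Zmu e

instance extMuRing (S : Type*) [Ring S] : Ring (ExtMu e S) :=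
  inferInstanceAs (Ring (S ⊗[ℤ] Zmu e))

instance extMuCommRing (S : Type*) [CommRing S] : CommRing (ExtMu e S) :=
  { extMuRing e S with
    mul_comm := fun x y => mul_comm (G := S ⊗[ℤ] Zmu e) x y }

variable {e}

/-- The pure tensor `s ⊗ u` in `S'`. -/
def extTmul {S : Type*} [Ring S] (s : S) (u : Zmu e) : ExtMu e S :=
  (s ⊗ₜ[ℤ] u : S ⊗[ℤ] Zmu e)

theorem extTmul_add_left {S : Type*} [Ring S] (s t : S) (u : Zmu e) :
    extTmul (s + t) u = extTmul s u + extTmul t u :=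
  TensorProduct.add_tmul s t u

theorem extTmul_zero_left {S : Type*} [Ring S] (u : Zmu e) :
    extTmul (0 : S) u = 0 :=
  TensorProduct.zero_tmul S u

theorem extTmul_mul {S : Type*} [Ring S] (s t : S) (u v : Zmu e) :
    extTmul s u * extTmul t v = extTmul (s * t) (u * v) :=
  Algebra.TensorProduct.tmul_mul_tmul s t u v

theorem extTmul_induction {S : Type*} [Ring S] {P : ExtMu e S → Prop} (x : ExtMu e S)
    (zero : P 0) (tmul : ∀ s u, P (extTmul s u)) (add : ∀ x y, P x → P y → P (x + y)) : P x :=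
  TensorProduct.induction_on (motive := fun z : S ⊗[ℤ] Zmu e => P z) x zero tmul add

/-- The automorphism `id ⊗ τ` of `S'`, for an automorphism `τ` of the ring `ℤ[μ_e]`. -/
def galExt (S : Type*) [Ring S] (τ : Zmu e ≃ₐ[ℤ] Zmu e) : ExtMu e S ≃+* ExtMu e S :=
  (Algebra.TensorProduct.congr (AlgEquiv.refl : S ≃ₐ[ℤ] S) τ :
    S ⊗[ℤ] Zmu e ≃ₐ[ℤ] S ⊗[ℤ] Zmu e).toRingEquiv

theorem galExt_extTmul {S : Type*} [Ring S] (τ : Zmu e ≃ₐ[ℤ] Zmu e) (s : S) (u : Zmu e) :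
    galExt S τ (extTmul s u) = extTmul s (τ u) := rfl

end Ext

section X

variable (e : Steinitz) (k : Type*) [CommRing k] (R : Type*) [Ring R] [Algebra k R]

/-- The ring homomorphism `k' → R'` induced by `k → R`. -/
def extMuMap : ExtMu e k →+* ExtMu e R :=
  (Algebra.TensorProduct.map (algebraMap k R).toIntAlgHom (AlgHom.id ℤ (Zmu e)) :
    k ⊗[ℤ] Zmu e →ₐ[ℤ] R ⊗[ℤ] Zmu e).toRingHom

theorem extMuMap_extTmul (c : k) (u : Zmu e) :
    extMuMap e k R (extTmul c u) = extTmul (algebraMap k R c) u := rfl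

theorem extMuMap_commutes (c : ExtMu e k) (x : ExtMu e R) :
    extMuMap e k R c * x = x * extMuMap e k R c := by
  refine extTmul_induction (P := fun c => extMuMap e k R c * x = x * extMuMap e k R c) c
    (by simp) (fun a u => ?_) fun a b ha hb => by
    rw [map_add, add_mul, mul_add, ha, hb]
  refine extTmul_induction (P := fun x => extMuMap e k R (extTmul a u) * x =
    x * extMuMap e k R (extTmul a u)) x (by simp) (fun r v => ?_) fun x y hx hy => by
    rw [add_mul, mul_add, hx, hy]
  rw [extMuMap_extTmul, extTmul_mul, extTmul_mul, Algebra.commutes, mul_comm u v]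

/-- `R'` is a `k'`-algebra. -/
instance extMuAlgebra : Algebra (ExtMu e k) (ExtMu e R) :=
  (extMuMap e k R).toAlgebra' (extMuMap_commutes e k R)

variable {e k R} in
theorem extTmul_smul (c : k) (u : Zmu e) (x : ExtMu e R) :
    extTmul c u • x = extTmul (algebraMap k R c) u * x := by
  rw [Algebra.smul_def]; rfl

/-- The group `A` of `k'`-algebra automorphisms of `R'`. -/
abbrev AutExt : Type _ := ExtMu e R ≃ₐ[ExtMu e k] ExtMu e R

/-- The compact-open topology on `A`, for the discrete topology on `R'`. The compact subsets of a
discrete space are the finite ones, so this is the topology of pointwise convergence. -/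
instance autExtTopology : TopologicalSpace (AutExt e k R) :=
  TopologicalSpace.induced (fun σ : AutExt e k R => (σ : ExtMu e R → ExtMu e R))
    (@Pi.topologicalSpace (ExtMu e R) (fun _ => ExtMu e R) (fun _ => ⊥))

variable {e k R}

/-- The eigenspace `R'(σ, ζ) = {x ∈ R' | σ x = ζ x}`. -/
def eigenExt (σ : AutExt e k R) (ζ : mu e) : Submodule (ExtMu e k) (ExtMu e R) :=
  Module.End.eigenspace (σ : ExtMu e R →ₗ[ExtMu e k] ExtMu e R) (extTmul (1 : k) (muToZmu ζ))

open Classical in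
/-- `σ` is `μ_e`-diagonalizable: `R'` is the direct sum of the eigenspaces `R'(σ, ζ)`, `ζ ∈ μ_e`. -/
def IsMuDiagonalizable (σ : AutExt e k R) : Prop :=
  DirectSum.IsInternal (fun ζ : mu e => eigenExt σ ζ)

variable (e k R)

/-- The set `X_e(R)` of `μ_e`-diagonalizable `σ ∈ A` with `τ_a σ τ_a⁻¹ = σ ^ a` for all units `a`
of `ℤ̂ / e ℤ̂`. Here `τ_a = id ⊗ τ`, where `τ` is the (unique) automorphism of `ℤ[μ_e]` with
`τ ζ = ζ ^ a` for all `ζ ∈ μ_e`, and `σ ^ a` is the linear map that acts on `R'(σ, ζ)` as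
multiplication by `ζ ^ a`. -/
def XSet : Set (AutExt e k R) :=
  {σ | IsMuDiagonalizable σ ∧
    ∀ (a : (ZHatMod e)ˣ) (τ : Zmu e ≃ₐ[ℤ] Zmu e),
      (∀ ζ : mu e, τ (muToZmu ζ) = muToZmu (muPow ζ (a : ZHatMod e))) →
      ∀ (ζ : mu e), ∀ x ∈ eigenExt σ ζ,
        galExt R τ (σ ((galExt R τ).symm x)) =
          extTmul (1 : k) (muToZmu (muPow ζ (a : ZHatMod e))) • x}

variable {e k R}

/-- The eigenspace in `R`: `R(σ, ζ) = {x ∈ R | σ (x ⊗ 1) = x ⊗ ζ}`. -/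
def eigenBase (σ : AutExt e k R) (ζ : mu e) : Submodule k R where
  carrier := {x | σ (extTmul x 1) = extTmul x (muToZmu ζ)}
  zero_mem' := by simp only [Set.mem_ofPred_eq, extTmul_zero_left, map_zero]
  add_mem' := fun {x y} hx hy => by
    simp only [Set.mem_ofPred_eq] at hx hy ⊢
    rw [extTmul_add_left, map_add, hx, hy, extTmul_add_left]
  smul_mem' := fun c x hx => by
    simp only [Set.mem_ofPred_eq] at hx ⊢
    have key : ∀ u : Zmu e, extTmul (c • x) u = extTmul c (1 : Zmu e) • extTmul x u := fun u => by
      rw [extTmul_smul, extTmul_mul, one_mul, Algebra.smul_def]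
    rw [key, map_smul, hx, ← key]

/-- The joint eigenspace `R_χ = ⋂_{δ ∈ Δ} R(δ, χ δ)` of a character `χ` of `Δ`. (The value `χ δ` is
an element of the circle group, and `R(δ, χ δ)` is formed when it lies in `μ_e`.) -/
def jointEigen (Δ : Subgroup (AutExt e k R)) (χ : PontryaginDual Δ) : Submodule k R :=
  ⨅ (δ : Δ) (ζ : mu e) (_ : (ζ : Circle) = χ δ), eigenBase (δ : AutExt e k R) ζ

end X

end

/-! Write R' for the base extension to ℤ[μ_e]. The theorem rests on a dictionary between X_e(R) and
gradings of R by μ_e. A Γ-grading and a homomorphism χ : Γ → μ_e give the automorphism `gradingAut`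
of R', scaling the γ-component by χ γ; it lies in X_e(R) (`gradingAut_mem_XSet`). Conversely, for σ
in X_e(R) the twisting condition makes the eigenprojections of σ commute with the Galois
automorphisms, so they descend to R and the spaces R(σ, ζ) form a μ_e-grading
(`isGroupGrading_eigenBase`). Descent is `mem_range_of_galExt_eq`: the Galois invariants of R' are
R. Torsion-freeness enters there, and in the fact that differences of distinct elements of μ_e act
injectively on R' (`SteinitzTorsionFree.eq_zero_of_smul_eq`).

If a universal grading with group Υ exists, the dictionary identifies X_e(R) with Hom(Υ, μ_e)
(`range_gradingAut_eq_XSet`). This is an abelian group, and it is compact because it is the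
continuous image of a closed subset of a product of finite sets (`isCompact_range_gradingAut`).

Now let Δ = X_e(R) be a compact abelian group. Orbits of Δ on R' are finite, so commuting
eigenprojections diagonalize R simultaneously (`iSup_jointEigen`), and the joint eigenspaces form a
grading by the dual of Δ. The characters with nonzero eigenspace generate the dual
(`closure_support_jointEigen`), by duality for finite abelian groups. Given any abelian e-torsion
grading 𝒜 with group Γ, each ψ : Γ → μ_e yields δ_ψ in Δ. A character χ of Δ is sent to the γ with ψ
γ = χ(δ_ψ) for all ψ. Such γ is unique because characters separate points, and it exists for χ in
the support by looking at a nonzero component, hence for all χ because the support generates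
(`exists_corresponds`). -/

noncomputable section

/-! ### Internal direct sums -/

section Internal

variable {ι : Type*} {k M : Type*} [Ring k] [AddCommGroup M] [Module k M]

open Classical in
/-- `M` is the internal direct sum of the submodules `A i`. The decidability instance is pinned. -/
def IsDirect (A : ι → Submodule k M) : Prop := DirectSum.IsInternal A

theorem isDirect_iff [DecidableEq ι] {A : ι → Submodule k M} :
    IsDirect A ↔ DirectSum.IsInternal A := by
  rw [IsDirect]
  convert Iff.rfl

open Classical in
theorem IsDirect.iSup_eq_top {A : ι → Submodule k M} (h : IsDirect A) : ⨆ i, A i = ⊤ :=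
  DirectSum.IsInternal.submodule_iSup_eq_top h

open Classical in
/-- An internal direct sum is isomorphic to the external one. -/
def internalEquiv {A : ι → Submodule k M} (h : IsDirect A) :
    (DirectSum ι fun i => A i) ≃ₗ[k] M :=
  LinearEquiv.ofBijective (DirectSum.coeLinearMap A) (show Function.Bijective _ from h)

open Classical in
/-- The projection of an internal direct sum onto one of its components. -/
def internalProj {A : ι → Submodule k M} (h : IsDirect A) (i : ι) : M →ₗ[k] M :=
  (A i).subtype ∘ₗ DirectSum.component k ι (fun i => A i) i ∘ₗ
    (internalEquiv h).symm.toLinearMap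

open Classical in
theorem internalProj_mem {A : ι → Submodule k M} (h : IsDirect A) (i : ι) (x : M) :
    internalProj h i x ∈ A i := by
  simp [internalProj]

open Classical in
theorem internal_symm_of_mem {A : ι → Submodule k M} (h : IsDirect A) {i : ι} {x : M}
    (hx : x ∈ A i) : (internalEquiv h).symm x =
      DirectSum.lof k ι (fun i => A i) i ⟨x, hx⟩ := by
  rw [LinearEquiv.symm_apply_eq]
  simp [internalEquiv]

open Classical in
theorem internalProj_of_mem {A : ι → Submodule k M} (h : IsDirect A) {i : ι} {x : M}
    (hx : x ∈ A i) : internalProj h i x = x := by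
  simp [internalProj, internal_symm_of_mem h hx, DirectSum.component.lof_self]

open Classical in
theorem internalProj_of_mem_ne {A : ι → Submodule k M} (h : IsDirect A) {i j : ι}
    (hij : i ≠ j) {x : M} (hx : x ∈ A i) : internalProj h j x = 0 := by
  simp [internalProj, internal_symm_of_mem h hx, DirectSum.component.of, hij]

open Classical in
theorem internal_induction {A : ι → Submodule k M} (h : IsDirect A) {P : M → Prop}
    (mem : ∀ i, ∀ x ∈ A i, P x) (zero : P 0) (add : ∀ x y, P x → P y → P (x + y)) (x : M) :
    P x := by
  have hx : x ∈ ⨆ i, A i := by rw [h.iSup_eq_top]; trivial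
  exact Submodule.iSup_induction A (motive := P) hx mem zero add

open Classical in
theorem internal_eq_zero {A : ι → Submodule k M} (h : IsDirect A) {x : M}
    (hx : ∀ i, internalProj h i x = 0) : x = 0 := by
  rw [← (internalEquiv h).symm.map_eq_zero_iff]
  refine DirectSum.ext_component k fun i => ?_
  have := hx i
  simpa [internalProj] using this

open Classical in
theorem exists_sum_internalProj {A : ι → Submodule k M} (h : IsDirect A) (x : M) :
    ∃ s : Finset ι, ∀ t, s ⊆ t → ∑ i ∈ t, internalProj h i x = x := by
  have hx : x ∈ ⨆ i, A i := by rw [h.iSup_eq_top]; trivial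
  refine Submodule.iSup_induction A (motive := fun x => ∃ s : Finset ι, ∀ t, s ⊆ t →
    ∑ i ∈ t, internalProj h i x = x) hx (fun i y hy => ⟨{i}, fun t ht => ?_⟩) ⟨∅, by simp⟩ ?_
  · rw [Finset.sum_eq_single i, internalProj_of_mem h hy]
    · exact fun j _ hj => internalProj_of_mem_ne h hj.symm hy
    · exact fun hi => (hi (ht (by simp))).elim
  · rintro y z ⟨s, hs⟩ ⟨t, ht⟩
    refine ⟨s ∪ t, fun v hv => ?_⟩
    simp only [map_add, Finset.sum_add_distrib]
    rw [hs v (Finset.union_subset_left hv), ht v (Finset.union_subset_right hv)]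

open Classical in
theorem isDirect_of_proj {A : ι → Submodule k M} (q : ι → M →ₗ[k] M)
    (hq : ∀ i, ∀ x ∈ A i, q i x = x) (hq' : ∀ i j, i ≠ j → ∀ x ∈ A i, q j x = 0)
    (htop : ⨆ i, A i = ⊤) : IsDirect A := by
  refine isDirect_iff.2 (DirectSum.isInternal_submodule_of_iSupIndep_of_iSup_eq_top (fun i => ?_) htop)
  rw [Submodule.disjoint_def]
  intro x hx hx'
  have hle : (⨆ (j) (_ : j ≠ i), A j) ≤ LinearMap.ker (q i) :=
    iSup₂_le fun j hj y hy => hq' j i hj y hy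
  rw [← hq i x hx]
  exact hle hx'

open Classical in
/-- Two decompositions, the second one direct, that are comparable are equal. -/
theorem internal_eq_of_le {A B : ι → Submodule k M} (hA : ⨆ i, A i = ⊤)
    (hB : IsDirect B) (h : ∀ i, A i ≤ B i) : A = B := by
  -- On an element of `A j`, the projections of B give the element itself or zero; since the `A j`
  -- span, the projections of B land in A.
  have key : ∀ x : M, ∀ i, internalProj hB i x ∈ A i := fun x => by
    have hx : x ∈ ⨆ i, A i := by rw [hA]; trivial
    refine Submodule.iSup_induction A (motive := fun x => ∀ i, internalProj hB i x ∈ A i) hx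
      (fun j y hy i => ?_) (fun i => by simp) fun y z hy hz i => by
        rw [map_add]; exact add_mem (hy i) (hz i)
    by_cases hij : j = i
    · subst hij
      rwa [internalProj_of_mem hB (h j hy)]
    · rw [internalProj_of_mem_ne hB hij (h j hy)]; exact zero_mem _
  funext i
  refine le_antisymm (h i) fun x hx => ?_
  rw [← internalProj_of_mem hB hx]
  exact key x i

open Classical in
/-- A component is contained in at most one component of a direct decomposition. -/
theorem internal_index_unique {A : ι → Submodule k M} (h : IsDirect A) {i j : ι} {x : M}
    (hx : x ≠ 0) (hi : x ∈ A i) (hj : x ∈ A j) : i = j := by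
  by_contra hij
  exact hx (by rw [← internalProj_of_mem h hj, internalProj_of_mem_ne h hij hi])

end Internal

/-! ### Arithmetic of `ℤ[μ_e]` -/

section Zmu

variable {e : Steinitz}

theorem muToZmu_mul (ζ ξ : mu e) : muToZmu (ζ * ξ) = muToZmu ζ * muToZmu ξ :=
  Subtype.ext (by simp [muToZmu])

theorem muToZmu_one : muToZmu (1 : mu e) = 1 :=
  Subtype.ext (by simp [muToZmu])

theorem muToZmu_pow (ζ : mu e) (n : ℕ) : muToZmu (ζ ^ n) = muToZmu ζ ^ n :=
  Subtype.ext (by simp [muToZmu])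

theorem muToZmu_injective : Function.Injective (muToZmu : mu e → Zmu e) := fun _ _ h =>
  Subtype.ext (Circle.ext (congrArg (Subtype.val : Zmu e → ℂ) h))

theorem mu_stDvd (ζ : mu e) : StDvd (orderOf ζ) e := by
  rw [← Subgroup.orderOf_coe]; exact ζ.2

theorem mem_mu_of_pow_eq_one {n : ℕ} (hn : StDvd n e) {z : Circle} (hz : z ^ n = 1) : z ∈ mu e :=
  hn.of_dvd (orderOf_dvd_of_pow_eq_one hz)

/-- An element of `ℤ[μ_e]` that is a root of unity of order dividing `e` comes from `μ_e`. -/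
theorem exists_muToZmu_eq {n : ℕ} (hn : StDvd n e) {u : Zmu e} (hu : u ^ n = 1) :
    ∃ ξ : mu e, muToZmu ξ = u := by
  have h1 : (u : ℂ) ^ n = 1 := by simpa using congrArg Subtype.val hu
  have h2 : ‖(u : ℂ)‖ = 1 := Complex.norm_eq_one_of_pow_eq_one h1 hn.1
  let z : Circle := ⟨u, mem_sphere_zero_iff_norm.2 h2⟩
  have hz : z ^ n = 1 := Circle.ext (by rw [Circle.coe_pow]; exact h1)
  exact ⟨⟨z, mem_mu_of_pow_eq_one hn hz⟩, Subtype.ext rfl⟩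

theorem Zmu_isIntegral (u : Zmu e) : IsIntegral ℤ u := by
  have h : Zmu e ≤ integralClosure ℤ ℂ := by
    refine Algebra.adjoin_le ?_
    rintro _ ⟨ζ, rfl⟩
    have hpos : 0 < orderOf ζ := Nat.pos_of_ne_zero (mu_stDvd ζ).1
    refine IsIntegral.of_pow hpos ?_
    have : ((ζ : Circle) : ℂ) ^ orderOf ζ = 1 := by
      rw [← Circle.coe_pow, ← Subgroup.coe_pow, pow_orderOf_eq_one ζ]
      rfl
    rw [this]
    exact isIntegral_one
  have h1 : IsIntegral ℤ (u : ℂ) := h u.2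
  exact (isIntegral_algHom_iff (Zmu e).val Subtype.val_injective).1 h1

/-- Being torsion-free and integral over ℤ, ℤ[μ_e] is faithfully flat; this is what allows descent
from R' to R. -/
instance Zmu_algebra_isIntegral : Algebra.IsIntegral ℤ (Zmu e) := ⟨Zmu_isIntegral⟩

/-- For `ζ ≠ 1` the element `1 - ζ` divides the order of `ζ`. -/
theorem exists_one_sub_mul_eq_orderOf {ζ : mu e} (hζ : ζ ≠ 1) :
    ∃ v : Zmu e, v * (1 - muToZmu ζ) = (orderOf ζ : Zmu e) := by
  have h0 : orderOf ζ ≠ 0 := (mu_stDvd ζ).1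
  have h1 : orderOf ζ ≠ 1 := fun h => hζ (orderOf_eq_one_iff.1 h)
  -- With order m + 2, the product of 1 - ζ ^ (i + 1) over i < m + 1 equals the order; it is
  -- nonempty and its factor at i = 0 is 1 - ζ.
  obtain ⟨m, hm⟩ : ∃ m, orderOf ζ = (m + 1) + 1 := ⟨orderOf ζ - 2, by omega⟩
  have hprim : IsPrimitiveRoot (muToZmu ζ) (m + 1 + 1) := by
    have := (IsPrimitiveRoot.orderOf ζ)
    rw [hm] at this
    refine ⟨by rw [← muToZmu_pow, this.pow_eq_one, muToZmu_one], fun l hl => this.dvd_of_pow_eq_one l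
      (muToZmu_injective (by rw [muToZmu_pow, hl, muToZmu_one]))⟩
  have := hprim.prod_one_sub_pow_eq_order
  rw [Finset.prod_range_succ'] at this
  exact ⟨_, by rw [hm]; simpa using this⟩

end Zmu

/-! ### The base extension -/

section Base

variable {e : Steinitz} {k : Type*} [CommRing k] {R : Type*} [Ring R] [Algebra k R]

theorem extTmul_add_right (x : R) (u v : Zmu e) :
    extTmul x (u + v) = extTmul x u + extTmul x v :=
  TensorProduct.tmul_add x u v

theorem extTmul_zero_right (x : R) : extTmul x (0 : Zmu e) = 0 :=
  TensorProduct.tmul_zero _ x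

theorem extTmul_sum_right {ι : Type*} (s : Finset ι) (x : R) (u : ι → Zmu e) :
    extTmul x (∑ i ∈ s, u i) = ∑ i ∈ s, extTmul x (u i) :=
  TensorProduct.tmul_sum x s u

theorem extTmul_sum_left {ι : Type*} (s : Finset ι) (x : ι → R) (u : Zmu e) :
    extTmul (∑ i ∈ s, x i) u = ∑ i ∈ s, extTmul (x i) u :=
  TensorProduct.sum_tmul s x u

theorem extTmul_intCast (x : R) (n : ℤ) : extTmul x (n : Zmu e) = extTmul (n • x) 1 := by
  have : (n : Zmu e) = n • (1 : Zmu e) := by simp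
  rw [this]
  exact TensorProduct.tmul_smul n x (1 : Zmu e) |>.trans (TensorProduct.smul_tmul' n x (1 : Zmu e))

theorem extTmul_one_one : extTmul (1 : R) (1 : Zmu e) = 1 := rfl

variable (k) in
theorem extTmul_one_smul_extTmul (u v : Zmu e) (x : R) :
    extTmul (1 : k) u • extTmul x v = extTmul x (u * v) := by
  rw [extTmul_smul, extTmul_mul, map_one, one_mul]

theorem extTmul_eq_smul (x : R) (u : Zmu e) :
    extTmul x u = extTmul (1 : k) u • extTmul x 1 := by
  rw [extTmul_one_smul_extTmul, mul_one]

theorem extTmul_smul_extTmul (c : k) (u v : Zmu e) (x : R) :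
    extTmul c u • extTmul x v = extTmul (c • x) (u * v) := by
  rw [extTmul_smul, extTmul_mul, Algebra.smul_def]

theorem galExt_smul (τ : Zmu e ≃ₐ[ℤ] Zmu e) (u : Zmu e) (x : ExtMu e R) :
    galExt R τ (extTmul (1 : k) u • x) = extTmul (1 : k) (τ u) • galExt R τ x := by
  simp only [extTmul_smul, map_mul, galExt_extTmul]

theorem extTmul_one_smul_smul (u v : Zmu e) (x : ExtMu e R) :
    extTmul (1 : k) u • extTmul (1 : k) v • x = extTmul (1 : k) (u * v) • x := by
  rw [smul_smul, extTmul_mul, one_mul]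

/-- Faithful flatness of ℤ[μ_e]; R may have torsion here. -/
theorem extTmul_left_injective : Function.Injective (fun x : R => extTmul x (1 : Zmu e)) := by
  have h := Module.FaithfullyFlat.tensorProduct_mk_injective (A := ℤ) (B := Zmu e) R
  intro x y hxy
  apply h
  have := congrArg (TensorProduct.comm ℤ R (Zmu e)) hxy
  exact this

variable (e R) in
/-- Multiplication by the divisors of `e` is injective on `R`. -/
abbrev SteinitzTorsionFree : Prop :=
  ∀ d : ℕ, StDvd d e → Function.Injective (fun x : R => d • x)

/-- Flatness of ℤ[μ_e] keeps multiplication by d injective after base extension. -/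
theorem SteinitzTorsionFree.eq_zero_of_nsmul (hinj : SteinitzTorsionFree e R) {d : ℕ} (hd : StDvd d e)
    {x : ExtMu e R} (hx : d • x = 0) : x = 0 := by
  let f : R →ₗ[ℤ] R := LinearMap.lsmul ℤ R d
  have hf : Function.Injective f := fun x y h => hinj d hd (by simpa [f] using h)
  have h2 : Function.Injective (f.rTensor (Zmu e)) := Module.Flat.rTensor_preserves_injective_linearMap f hf
  have h3 : ∀ y : R ⊗[ℤ] Zmu e, f.rTensor (Zmu e) y = d • y := fun y => by
    have : f = (d : ℤ) • LinearMap.id := by ext; simp [f]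
    rw [this, LinearMap.rTensor_smul]
    simp
  have h4 : f.rTensor (Zmu e) x = f.rTensor (Zmu e) 0 :=
    (h3 x).trans (hx.trans (map_zero (f.rTensor (Zmu e))).symm)
  exact h2 h4

/-- Differences of distinct roots of unity in `μ_e` act injectively. -/
theorem SteinitzTorsionFree.eq_zero_of_smul_eq (hinj : SteinitzTorsionFree e R) {ζ ξ : mu e}
    (hne : ζ ≠ ξ) {x : ExtMu e R}
    (hx : extTmul (1 : k) (muToZmu ζ) • x = extTmul (1 : k) (muToZmu ξ) • x) : x = 0 := by
  -- The hypothesis says that ζ⁻¹ξ fixes x. Hence 1 - ζ⁻¹ξ kills x, and so does its multiple, the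
  -- order of ζ⁻¹ξ, which divides e.
  have hne' : ζ⁻¹ * ξ ≠ 1 := fun h => hne (inv_mul_eq_one.1 h)
  obtain ⟨v, hv⟩ := exists_one_sub_mul_eq_orderOf hne'
  refine hinj.eq_zero_of_nsmul (mu_stDvd (ζ⁻¹ * ξ)) ?_
  have h1 : (orderOf (ζ⁻¹ * ξ) : ExtMu e k) = extTmul (1 : k) (v * (1 - muToZmu (ζ⁻¹ * ξ))) := by
    rw [hv]
    have := map_natCast (Algebra.TensorProduct.includeRight : Zmu e →ₐ[ℤ] k ⊗[ℤ] Zmu e)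
      (orderOf (ζ⁻¹ * ξ))
    exact this.symm
  rw [← Nat.cast_smul_eq_nsmul (ExtMu e k), h1, mul_sub, mul_one, muToZmu_mul]
  have h2 : extTmul (1 : k) v • x = extTmul (1 : k) (v * (muToZmu ζ⁻¹ * muToZmu ξ)) • x := by
    rw [← extTmul_one_smul_smul, ← extTmul_one_smul_smul, ← hx, extTmul_one_smul_smul (muToZmu ζ⁻¹),
      ← muToZmu_mul, inv_mul_cancel, muToZmu_one, extTmul_one_smul_smul, mul_one]
  have h3 : extTmul (1 : k) (v - v * (muToZmu ζ⁻¹ * muToZmu ξ)) =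
    extTmul (1 : k) v - extTmul (1 : k) (v * (muToZmu ζ⁻¹ * muToZmu ξ)) := TensorProduct.tmul_sub _ _ _
  rw [h3, sub_smul, ← h2, sub_self]

theorem extTmul_eq_zero_of_ne (hinj : SteinitzTorsionFree e R) {ζ ξ : mu e}
    (hne : ζ ≠ ξ) {x : R} (hx : extTmul x (muToZmu ζ) = extTmul x (muToZmu ξ)) : x = 0 := by
  refine extTmul_left_injective (e := e) ?_
  simp only [extTmul_zero_left]
  refine hinj.eq_zero_of_smul_eq (k := ℤ) hne ?_
  simpa only [extTmul_one_smul_extTmul, mul_one] using hx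

theorem algEquiv_ext_extTmul {σ σ' : AutExt e k R}
    (h : ∀ x : R, σ (extTmul x 1) = σ' (extTmul x 1)) : σ = σ' := by
  refine AlgEquiv.ext fun x => ?_
  refine extTmul_induction (P := fun x => σ x = σ' x) x (by simp) (fun s u => ?_) fun x y hx hy => by
    rw [map_add, map_add, hx, hy]
  rw [extTmul_eq_smul (k := k), map_smul, map_smul, h]

theorem apply_extTmul_of_mem {σ : AutExt e k R} {ζ : mu e} {x : R} (hx : x ∈ eigenBase σ ζ)
    (u : Zmu e) : σ (extTmul x u) = extTmul x (muToZmu ζ * u) := by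
  have hx : σ (extTmul x 1) = extTmul x (muToZmu ζ) := hx
  rw [extTmul_eq_smul (k := k), map_smul, hx, extTmul_one_smul_extTmul, mul_comm]

theorem mem_eigenBase {σ : AutExt e k R} {ζ : mu e} {x : R} :
    x ∈ eigenBase σ ζ ↔ σ (extTmul x 1) = extTmul x (muToZmu ζ) := Iff.rfl

theorem mem_eigenExt {σ : AutExt e k R} {ζ : mu e} {x : ExtMu e R} :
    x ∈ eigenExt σ ζ ↔ σ x = extTmul (1 : k) (muToZmu ζ) • x :=
  Module.End.mem_eigenspace_iff

theorem extTmul_one_mem_eigenExt {σ : AutExt e k R} {ζ : mu e} {x : R} :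
    extTmul x 1 ∈ eigenExt σ ζ ↔ x ∈ eigenBase σ ζ := by
  rw [mem_eigenExt, extTmul_one_smul_extTmul, mul_one, mem_eigenBase]

variable (e) in
/-- The base extension of a `k`-linear endomorphism of `R`. -/
def baseMap (p : R →ₗ[k] R) : ExtMu e R →ₗ[ExtMu e k] ExtMu e R where
  toFun := (p.restrictScalars ℤ).rTensor (Zmu e)
  map_add' x y := map_add ((p.restrictScalars ℤ).rTensor (Zmu e)) x y
  map_smul' c x := by
    let f : ExtMu e R →+ ExtMu e R := ((p.restrictScalars ℤ).rTensor (Zmu e)).toAddMonoidHom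
    change f (c • x) = c • f x
    refine extTmul_induction (P := fun c => f (c • x) = c • f x) c (by simp) (fun a u => ?_)
      fun a b ha hb => by rw [add_smul, map_add, ha, hb, add_smul]
    refine extTmul_induction (P := fun x => f (extTmul a u • x) = extTmul a u • f x) x (by simp)
      (fun y v => ?_) fun x y hx hy => by rw [smul_add, map_add, hx, hy, map_add, smul_add]
    have hf : ∀ (y : R) (v : Zmu e), f (extTmul y v) = extTmul (p y) v := fun y v => rfl
    rw [hf, extTmul_smul_extTmul, hf, extTmul_smul_extTmul, map_smul]

theorem baseMap_extTmul (p : R →ₗ[k] R) (x : R) (u : Zmu e) :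
    baseMap e p (extTmul x u) = extTmul (p x) u := rfl

end Base

/-! ### Automorphisms of `μ_e` and of `ℤ[μ_e]` -/

section Automorphisms

variable {e : Steinitz}

theorem exists_mu_orderOf_eq {d : ℕ} (hd : StDvd d e) : ∃ ζ : mu e, orderOf ζ = d := by
  have hp := Complex.isPrimitiveRoot_exp d hd.1
  let z : Circle := ⟨_, mem_sphere_zero_iff_norm.2 (hp.norm'_eq_one hd.1)⟩
  have hz : orderOf z = d := by
    rw [← orderOf_injective Circle.coeHom Circle.coe_injective z]
    exact hp.eq_orderOf.symm
  refine ⟨⟨z, by change StDvd (orderOf z) e; rwa [hz]⟩, ?_⟩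
  rw [← Subgroup.orderOf_coe]
  exact hz

theorem exists_pow_of_orderOf_eq {d : ℕ} (hd : StDvd d e) {g ζ : mu e} (hg : orderOf g = d)
    (hζ : ζ ^ d = 1) : ∃ j : ℕ, ζ = g ^ j := by
  have hprim : IsPrimitiveRoot (muToZmu g) d := by
    have := IsPrimitiveRoot.orderOf g
    rw [hg] at this
    refine ⟨by rw [← muToZmu_pow, this.pow_eq_one, muToZmu_one], fun l hl => this.dvd_of_pow_eq_one l
      (muToZmu_injective (by rw [muToZmu_pow, hl, muToZmu_one]))⟩
  have : NeZero d := ⟨hd.1⟩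
  obtain ⟨j, -, hj⟩ := hprim.eq_pow_of_pow_eq_one (ξ := muToZmu ζ)
    (by rw [← muToZmu_pow, hζ, muToZmu_one])
  exact ⟨j, muToZmu_injective (by rw [muToZmu_pow, hj])⟩

/-- Compatibility of the coordinates of a frees the exponent from the exact order of ζ, so that
different roots of unity can share one modulus. -/
theorem muPow_eq_pow {d : ℕ} (hd : StDvd d e) {ζ : mu e} (hζ : ζ ^ d = 1) (a : ZHatMod e) :
    muPow ζ a = ζ ^ (a.1 ⟨d, hd⟩).val := by
  have hdvd : orderOf (ζ : Circle) ∣ d := by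
    rw [Subgroup.orderOf_coe]; exact orderOf_dvd_of_pow_eq_one hζ
  have h := a.2 ⟨orderOf (ζ : Circle), ζ.2⟩ ⟨d, hd⟩ hdvd
  have : NeZero d := ⟨hd.1⟩
  have : NeZero (orderOf (ζ : Circle)) := ⟨ζ.2.1⟩
  rw [muPow, ← h, pow_eq_pow_iff_modEq, ← Subgroup.orderOf_coe, ← ZMod.natCast_eq_natCast_iff]
  rw [ZMod.natCast_zmod_val, ZMod.castHom_apply, ZMod.cast_eq_val]

theorem muPow_one (ζ : mu e) : muPow ζ 1 = ζ := by
  have hζ : ζ ^ orderOf ζ = 1 := pow_orderOf_eq_one ζ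
  rw [muPow_eq_pow (mu_stDvd ζ) hζ]
  conv_rhs => rw [← pow_one ζ]
  rw [pow_eq_pow_iff_modEq]
  have : NeZero (orderOf ζ) := ⟨(mu_stDvd ζ).1⟩
  rw [← ZMod.natCast_eq_natCast_iff, ZMod.natCast_zmod_val]
  simp

theorem muPow_mul (ζ : mu e) (a b : ZHatMod e) : muPow ζ (a * b) = muPow (muPow ζ a) b := by
  have hζ : ζ ^ orderOf ζ = 1 := pow_orderOf_eq_one ζ
  rw [muPow_eq_pow (mu_stDvd ζ) hζ, muPow_eq_pow (mu_stDvd ζ) hζ, muPow_eq_pow (mu_stDvd ζ)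
    (by rw [← pow_mul, mul_comm, pow_mul, hζ, one_pow]), ← pow_mul, pow_eq_pow_iff_modEq]
  have : NeZero (orderOf ζ) := ⟨(mu_stDvd ζ).1⟩
  rw [← ZMod.natCast_eq_natCast_iff, ZMod.natCast_zmod_val]
  simp

theorem ZHatMod_ext {a b : ZHatMod e} (h : ∀ ζ, muPow ζ a = muPow ζ b) : a = b := by
  refine Subtype.ext (funext fun d => ?_)
  obtain ⟨g, hg⟩ := exists_mu_orderOf_eq d.2
  have hg' : g ^ d.1 = 1 := by rw [← hg]; exact pow_orderOf_eq_one g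
  have := h g
  rw [muPow_eq_pow d.2 hg', muPow_eq_pow d.2 hg', pow_eq_pow_iff_modEq, hg,
    ← ZMod.natCast_eq_natCast_iff] at this
  have hd : NeZero d.1 := ⟨d.2.1⟩
  simpa only [ZMod.natCast_zmod_val] using this

/-- Every endomorphism of `μ_e` is exponentiation by an element of `ℤ̂ / e ℤ̂`. -/
theorem exists_muPow_eq (f : mu e →* mu e) : ∃ a : ZHatMod e, ∀ ζ, f ζ = muPow ζ a := by
  -- The d-torsion of μ_e is cyclic, so f acts on it as a power map determined by the image of a
  -- generator. Compatibility for c ∣ d is then read off at a generator of order c.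
  have key : ∀ d : {d : ℕ // StDvd d e}, ∃ a : ZMod d.1, ∀ ζ : mu e, ζ ^ d.1 = 1 →
      f ζ = ζ ^ a.val := fun d => by
    have : NeZero d.1 := ⟨d.2.1⟩
    obtain ⟨g, hg⟩ := exists_mu_orderOf_eq d.2
    have hg' : g ^ d.1 = 1 := by rw [← hg]; exact pow_orderOf_eq_one g
    obtain ⟨m, hm⟩ := exists_pow_of_orderOf_eq d.2 hg (ζ := f g) (by rw [← map_pow, hg', map_one])
    refine ⟨m, fun ζ hζ => ?_⟩
    obtain ⟨j, rfl⟩ := exists_pow_of_orderOf_eq d.2 hg hζ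
    rw [map_pow, hm, ← pow_mul, ← pow_mul, pow_eq_pow_iff_modEq, hg,
      ← ZMod.natCast_eq_natCast_iff]
    simp [mul_comm]
  choose a ha using key
  refine ⟨⟨a, fun c d h => ?_⟩, fun ζ => ?_⟩
  · obtain ⟨g, hg⟩ := exists_mu_orderOf_eq c.2
    have hg' : g ^ c.1 = 1 := by rw [← hg]; exact pow_orderOf_eq_one g
    have hg'' : g ^ d.1 = 1 := by
      obtain ⟨l, hl⟩ := h
      rw [hl, pow_mul, hg', one_pow]
    have := (ha c g hg').symm.trans (ha d g hg'')
    rw [pow_eq_pow_iff_modEq, hg, ← ZMod.natCast_eq_natCast_iff] at this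
    have hc : NeZero c.1 := ⟨c.2.1⟩
    have hd : NeZero d.1 := ⟨d.2.1⟩
    rw [ZMod.natCast_zmod_val] at this
    rw [this, ZMod.castHom_apply, ZMod.cast_eq_val]
  · refine ha ⟨orderOf (ζ : Circle), ζ.2⟩ ζ ?_
    change ζ ^ orderOf (ζ : Circle) = 1
    rw [Subgroup.orderOf_coe, pow_orderOf_eq_one]

/-- The endomorphism of `μ_e` induced by an endomorphism of the ring `ℤ[μ_e]`. -/
theorem exists_muHom (τ : Zmu e →ₐ[ℤ] Zmu e) :
    ∃ f : mu e →* mu e, ∀ ζ, τ (muToZmu ζ) = muToZmu (f ζ) := by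
  have h : ∀ ζ : mu e, ∃ ξ : mu e, muToZmu ξ = τ (muToZmu ζ) := fun ζ =>
    exists_muToZmu_eq (mu_stDvd ζ) (by
      rw [← map_pow, ← muToZmu_pow, pow_orderOf_eq_one, muToZmu_one, map_one])
  choose f hf using h
  refine ⟨⟨⟨f, muToZmu_injective ?_⟩, fun x y => muToZmu_injective ?_⟩, fun ζ => (hf ζ).symm⟩
  · rw [hf, muToZmu_one, map_one]
  · change muToZmu (f (x * y)) = muToZmu (f x * f y)
    rw [hf, muToZmu_mul, map_mul, muToZmu_mul, hf, hf]

/-- Every automorphism of `ℤ[μ_e]` is induced by a unit of `ℤ̂ / e ℤ̂`. -/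
theorem exists_unit_muPow (τ : Zmu e ≃ₐ[ℤ] Zmu e) : ∃ a : (ZHatMod e)ˣ, ∀ ζ : mu e,
    τ (muToZmu ζ) = muToZmu (muPow ζ (a : ZHatMod e)) := by
  have h : ∀ τ : Zmu e ≃ₐ[ℤ] Zmu e, ∃ a : ZHatMod e, ∀ ζ : mu e,
      τ (muToZmu ζ) = muToZmu (muPow ζ a) := fun τ => by
    obtain ⟨f, hf⟩ := exists_muHom τ.toAlgHom
    obtain ⟨a, ha⟩ := exists_muPow_eq f
    exact ⟨a, fun ζ => by rw [← ha, ← hf]; rfl⟩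
  obtain ⟨a, ha⟩ := h τ
  obtain ⟨b, hb⟩ := h τ.symm
  refine ⟨⟨a, b, ZHatMod_ext fun ζ => muToZmu_injective ?_,
    ZHatMod_ext fun ζ => muToZmu_injective ?_⟩, ha⟩
  · rw [muPow_mul, muPow_one, ← hb, ← ha, τ.symm_apply_apply]
  · rw [muPow_mul, muPow_one, ← ha, ← hb, τ.apply_symm_apply]

/-! ### Galois automorphisms -/

/-- The field of algebraic numbers. -/
abbrev AlgNum : IntermediateField ℚ ℂ := algebraicClosure ℚ ℂ

instance AlgNum_isAlgebraic : Algebra.IsAlgebraic ℚ AlgNum := algebraicClosure.isAlgebraic ℚ ℂ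

/-- Normality allows automorphisms of a cyclotomic field to be extended to all algebraic numbers,
and then restricted to ℤ[μ_e], which need not be finite over ℤ. -/
instance AlgNum_normal : Normal ℚ AlgNum := by
  have : IsAlgClosure ℚ AlgNum := algebraicClosure.isAlgClosure ℚ ℂ
  exact IsAlgClosure.normal ℚ AlgNum

theorem Zmu_mem_algNum (u : Zmu e) : (u : ℂ) ∈ AlgNum := by
  rw [mem_algebraicClosure_iff']
  have h : IsIntegral ℤ (u : ℂ) := (Zmu_isIntegral u).map (Zmu e).val
  exact h.tower_top

/-- An element of `ℤ[μ_e]` as an algebraic number. -/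
def toAlgNum : Zmu e →ₐ[ℤ] AlgNum where
  toFun u := ⟨u, Zmu_mem_algNum u⟩
  map_one' := rfl
  map_mul' _ _ := rfl
  map_zero' := rfl
  map_add' _ _ := rfl
  commutes' _ := rfl

theorem toAlgNum_injective : Function.Injective (toAlgNum (e := e)) := fun _ _ h =>
  Subtype.ext (congrArg (Subtype.val : AlgNum → ℂ) h)

/-- An n-th root of unity is sent to an n-th root of unity, so the generators in μ_e are permuted
among themselves. -/
theorem algNum_apply_mem (g : AlgNum ≃ₐ[ℚ] AlgNum) (u : Zmu e) : (g (toAlgNum u) : ℂ) ∈ Zmu e := by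
  have h : ∀ z : ℂ, ∀ hz : z ∈ Zmu e, (g (toAlgNum ⟨z, hz⟩) : ℂ) ∈ Zmu e := by
    intro z hz
    refine Algebra.adjoin_induction (R := ℤ)
      (p := fun z hz => (g (toAlgNum (e := e) ⟨z, hz⟩) : ℂ) ∈ Zmu e) ?_ ?_ ?_ ?_ hz
    · rintro _ ⟨ζ, rfl⟩
      have h1 : muToZmu ζ ^ orderOf ζ = 1 := by
        rw [← muToZmu_pow, pow_orderOf_eq_one, muToZmu_one]
      have h2 : (g (toAlgNum (muToZmu ζ)) : ℂ) ^ orderOf ζ = 1 := by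
        have := congrArg (fun u => (g (toAlgNum u) : ℂ)) h1
        simpa using this
      have h3 := Complex.norm_eq_one_of_pow_eq_one h2 (mu_stDvd ζ).1
      let z : Circle := ⟨_, mem_sphere_zero_iff_norm.2 h3⟩
      have hz : z ^ orderOf ζ = 1 := Circle.ext (by rw [Circle.coe_pow]; exact h2)
      exact Algebra.subset_adjoin ⟨⟨z, mem_mu_of_pow_eq_one (mu_stDvd ζ) hz⟩, rfl⟩
    · intro n
      have : g (toAlgNum (algebraMap ℤ (Zmu e) n)) = (n : AlgNum) := by
        rw [AlgHom.commutes]; simp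
      have h : (g (toAlgNum (algebraMap ℤ (Zmu e) n)) : ℂ) = algebraMap ℤ ℂ n := by
        rw [this]; simp
      change (g (toAlgNum (algebraMap ℤ (Zmu e) n)) : ℂ) ∈ _
      rw [h]
      exact (Zmu e).algebraMap_mem n
    · intro x y hx hy h1 h2
      have : toAlgNum (e := e) ⟨x + y, add_mem hx hy⟩ =
        toAlgNum (e := e) ⟨x, hx⟩ + toAlgNum (e := e) ⟨y, hy⟩ := rfl
      rw [this, map_add]
      exact add_mem h1 h2
    · intro x y hx hy h1 h2
      have : toAlgNum (e := e) ⟨x * y, mul_mem hx hy⟩ =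
        toAlgNum (e := e) ⟨x, hx⟩ * toAlgNum (e := e) ⟨y, hy⟩ := rfl
      rw [this, map_mul]
      exact mul_mem h1 h2
  exact h u u.2

/-- An automorphism of the field of algebraic numbers acts on `ℤ[μ_e]`. -/
def galHom (g : AlgNum ≃ₐ[ℚ] AlgNum) : Zmu e →ₐ[ℤ] Zmu e :=
  (((AlgNum.val.restrictScalars ℤ).comp (g.toAlgHom.restrictScalars ℤ)).comp toAlgNum).codRestrict
    (Zmu e) (algNum_apply_mem g)

theorem toAlgNum_galHom (g : AlgNum ≃ₐ[ℚ] AlgNum) (u : Zmu e) :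
    toAlgNum (galHom g u) = g (toAlgNum u) := rfl

/-- An automorphism of the field of algebraic numbers restricts to an automorphism of `ℤ[μ_e]`. -/
def galZmu (g : AlgNum ≃ₐ[ℚ] AlgNum) : Zmu e ≃ₐ[ℤ] Zmu e :=
  AlgEquiv.ofAlgHom (galHom g) (galHom g.symm)
    (AlgHom.ext fun u => toAlgNum_injective (by simp [toAlgNum_galHom]))
    (AlgHom.ext fun u => toAlgNum_injective (by simp [toAlgNum_galHom]))

theorem toAlgNum_galZmu (g : AlgNum ≃ₐ[ℚ] AlgNum) (u : Zmu e) :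
    toAlgNum (galZmu g u) = g (toAlgNum u) := rfl

/-- The family lifts Gal(ℚ(ζ)/ℚ). Its sums over powers of ζ are traces of algebraic integers, hence
integers, and only the identity of the Galois group fixes ζ. The member at `i₀` is some lift of that
identity; all that matters is that it fixes ζ. -/
theorem exists_trace_family (ζ : mu e) : ∃ (ι : Type) (_ : Fintype ι) (τ : ι → (Zmu e ≃ₐ[ℤ] Zmu e))
    (i₀ : ι), (∀ j : ℕ, ∃ c : ℤ, ∑ i, τ i (muToZmu ζ ^ j) = c) ∧
      ∀ i, τ i (muToZmu ζ) = muToZmu ζ ↔ i = i₀ := by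
  set z : AlgNum := toAlgNum (muToZmu ζ) with hz
  set n := orderOf ζ with hn
  have hn0 : n ≠ 0 := (mu_stDvd ζ).1
  have : NeZero n := ⟨hn0⟩
  have hprim : IsPrimitiveRoot z n := by
    have := IsPrimitiveRoot.orderOf ζ
    refine ⟨by rw [hz, ← map_pow, ← muToZmu_pow, this.pow_eq_one, muToZmu_one, map_one],
      fun l hl => this.dvd_of_pow_eq_one l (muToZmu_injective (toAlgNum_injective
        (by rw [muToZmu_pow, map_pow, ← hz, hl, muToZmu_one, map_one])))⟩
  let L : IntermediateField ℚ AlgNum := IntermediateField.adjoin ℚ {z}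
  have : IsCyclotomicExtension {n} ℚ L := hprim.intermediateField_adjoin_isCyclotomicExtension ℚ
  have : FiniteDimensional ℚ L := IsCyclotomicExtension.finiteDimensional {n} ℚ L
  have : IsGalois ℚ L := IsCyclotomicExtension.isGalois {n} ℚ L
  let y : L := IntermediateField.AdjoinSimple.gen ℚ z
  have hy : algebraMap L AlgNum y = z := IntermediateField.AdjoinSimple.algebraMap_gen ℚ z
  let τ : (L ≃ₐ[ℚ] L) → (Zmu e ≃ₐ[ℤ] Zmu e) := fun g => galZmu (g.liftNormal AlgNum)
  have hτ : ∀ g j, toAlgNum (τ g (muToZmu ζ ^ j)) = algebraMap L AlgNum (g (y ^ j)) := fun g j => by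
    rw [toAlgNum_galZmu, ← AlgEquiv.liftNormal_commutes, map_pow, map_pow, map_pow (algebraMap L AlgNum), hy, map_pow]
  refine ⟨L ≃ₐ[ℚ] L, inferInstance, τ, 1, fun j => ?_, fun g => ⟨fun h => ?_, ?_⟩⟩
  · have hint : IsIntegral ℤ (y ^ j) := by
      refine IsIntegral.pow ?_ j
      have h1 : IsIntegral ℤ (algebraMap L AlgNum y) := by
        rw [hy]; exact (Zmu_isIntegral (muToZmu ζ)).map toAlgNum
      exact (isIntegral_algebraMap_iff (algebraMap L AlgNum).injective).1 h1
    have htr : IsIntegral ℤ (Algebra.trace ℚ L (y ^ j)) := Algebra.isIntegral_trace hint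
    obtain ⟨c, hc⟩ := IsIntegrallyClosed.isIntegral_iff.1 htr
    refine ⟨c, toAlgNum_injective ?_⟩
    rw [map_sum]
    simp only [hτ]
    rw [← map_sum, ← trace_eq_sum_automorphisms, ← hc]
    simp
  · have h1 := hτ g 1
    rw [pow_one, h, ← hz, pow_one, ← hy] at h1
    have h2 : g y = y := ((algebraMap L AlgNum).injective h1).symm
    refine AlgEquiv.coe_toAlgHom_injective (IntermediateField.adjoin_algHom_ext ℚ ?_)
    intro x hx
    obtain rfl : x = z := hx
    exact h2
  · rintro rfl
    have h1 := hτ 1 1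
    rw [pow_one, pow_one, AlgEquiv.one_apply, hy] at h1
    exact toAlgNum_injective h1

end Automorphisms

/-! ### Galois invariants of the base extension -/

section Invariants

variable {e : Steinitz} {R : Type*} [Ring R]

variable (e R) in
/-- The additive subgroup of `R'` generated by the tensors `r ⊗ z` with `z ^ n = 1`. -/
def cyclotomicPart (n : ℕ) : AddSubgroup (ExtMu e R) :=
  AddSubgroup.closure {y | ∃ (r : R) (z : mu e), z ^ n = 1 ∧ y = extTmul r (muToZmu z)}

theorem cyclotomicPart_mono {m n : ℕ} (h : m ∣ n) : cyclotomicPart e R m ≤ cyclotomicPart e R n := by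
  refine AddSubgroup.closure_mono ?_
  rintro _ ⟨r, z, hz, rfl⟩
  obtain ⟨l, rfl⟩ := h
  exact ⟨r, z, by rw [pow_mul, hz, one_pow], rfl⟩

/-- μ_e is closed under products, so the ring it generates is its ℤ-span. -/
theorem Zmu_induction {P : Zmu e → Prop} (u : Zmu e) (mem : ∀ ζ : mu e, P (muToZmu ζ)) (zero : P 0)
    (add : ∀ x y, P x → P y → P (x + y)) (smul : ∀ (n : ℤ) (x), P x → P (n • x)) : P u := by
  set S : Set ℂ := {z : ℂ | ∃ ζ : mu e, ((ζ : Circle) : ℂ) = z} with hS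
  have h1 : (u : ℂ) ∈ Submodule.span ℤ (Submonoid.closure S : Set ℂ) := by
    rw [← Algebra.adjoin_eq_span]; exact u.2
  have h2 : ∃ v : Zmu e, (v : ℂ) = u ∧ P v := by
    refine Submodule.span_induction (p := fun z _ => ∃ v : Zmu e, (v : ℂ) = z ∧ P v) ?_ ?_ ?_ ?_ h1
    · intro z hz
      have : z ∈ S := by
        refine Submonoid.closure_induction (motive := fun z _ => z ∈ S) (fun x hx => hx) ⟨1, rfl⟩ ?_ hz
        rintro _ _ _ _ ⟨ζ, rfl⟩ ⟨ξ, rfl⟩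
        exact ⟨ζ * ξ, rfl⟩
      obtain ⟨ζ, rfl⟩ := this
      exact ⟨muToZmu ζ, rfl, mem ζ⟩
    · exact ⟨0, rfl, zero⟩
    · rintro _ _ _ _ ⟨v, rfl, hv⟩ ⟨v', rfl, hv'⟩
      exact ⟨v + v', rfl, add _ _ hv hv'⟩
    · rintro n _ _ ⟨v, rfl, hv⟩
      exact ⟨n • v, rfl, smul n _ hv⟩
  obtain ⟨v, hv, hP⟩ := h2
  rwa [← Subtype.ext hv]

/-- Only finitely many roots of unity occur in x, and their orders have a least common multiple
dividing e. -/
theorem exists_mem_cyclotomicPart (x : ExtMu e R) : ∃ n, StDvd n e ∧ x ∈ cyclotomicPart e R n := by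
  have hadd : ∀ x y : ExtMu e R, (∃ n, StDvd n e ∧ x ∈ cyclotomicPart e R n) →
      (∃ n, StDvd n e ∧ y ∈ cyclotomicPart e R n) →
      ∃ n, StDvd n e ∧ x + y ∈ cyclotomicPart e R n := by
    rintro x y ⟨m, hm, hx⟩ ⟨n, hn, hy⟩
    exact ⟨_, hm.lcm hn, add_mem (cyclotomicPart_mono (Nat.dvd_lcm_left m n) hx)
      (cyclotomicPart_mono (Nat.dvd_lcm_right m n) hy)⟩
  refine extTmul_induction (P := fun x => ∃ n, StDvd n e ∧ x ∈ cyclotomicPart e R n) x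
    ⟨1, StDvd.one e, zero_mem _⟩ (fun r u => ?_) hadd
  refine Zmu_induction (P := fun u => ∃ n, StDvd n e ∧ extTmul r u ∈ cyclotomicPart e R n) u
    (fun ζ => ⟨orderOf ζ, mu_stDvd ζ, ?_⟩) ⟨1, StDvd.one e, ?_⟩ (fun u v hu hv => ?_)
    fun n u hu => ?_
  · exact AddSubgroup.subset_closure ⟨r, ζ, pow_orderOf_eq_one ζ, rfl⟩
  · rw [extTmul_zero_right]; exact zero_mem _
  · rw [extTmul_add_right]; exact hadd _ _ hu hv
  · obtain ⟨m, hm, hu⟩ := hu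
    refine ⟨m, hm, ?_⟩
    have : extTmul r (n • u) = n • extTmul r u := TensorProduct.tmul_smul n r u
    rw [this]
    exact zsmul_mem hu n

variable (e R) in
/-- The canonical map `R → R'`. -/
def baseInl : R →+ ExtMu e R where
  toFun r := extTmul r 1
  map_zero' := extTmul_zero_left 1
  map_add' r s := extTmul_add_left r s 1

/-- If nx = r ⊗ 1, then r dies in (R/nR) ⊗ ℤ[μ_e], so r = ns by faithful flatness; cancelling n
gives x = s ⊗ 1. -/
theorem mem_range_of_nsmul_mem (hinj : SteinitzTorsionFree e R) {n : ℕ} (hn : StDvd n e)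
    {x : ExtMu e R} (hx : n • x ∈ (baseInl e R).range) : x ∈ (baseInl e R).range := by
  obtain ⟨r, hr⟩ := hx
  have hr : extTmul r 1 = n • x := hr
  let N : Submodule ℤ R := LinearMap.range (LinearMap.lsmul ℤ R (n : ℤ))
  have h0 : (N.mkQ r : R ⧸ N) = 0 := by
    apply Module.FaithfullyFlat.tensorProduct_mk_injective (A := ℤ) (B := Zmu e) (R ⧸ N)
    have h1 : N.mkQ.rTensor (Zmu e) (r ⊗ₜ 1) = 0 := by
      obtain ⟨y, hy⟩ : ∃ y : R ⊗[ℤ] Zmu e, y = x := ⟨x, rfl⟩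
      have h2 : (r ⊗ₜ[ℤ] (1 : Zmu e)) = (n : ℤ) • y := by
        subst hy
        exact hr.trans (natCast_zsmul _ n).symm
      rw [h2, map_zsmul]
      have h3 : ∀ y : (R ⧸ N) ⊗[ℤ] Zmu e, (n : ℤ) • y = 0 := fun y => by
        induction y with
        | zero => simp
        | add y z hy hz => rw [smul_add, hy, hz, add_zero]
        | tmul y u =>
          obtain ⟨y, rfl⟩ := N.mkQ_surjective y
          rw [TensorProduct.smul_tmul', ← map_zsmul]
          have : N.mkQ ((n : ℤ) • y) = 0 := by
            rw [Submodule.mkQ_apply, Submodule.Quotient.mk_eq_zero]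
            exact ⟨y, rfl⟩
          rw [this, TensorProduct.zero_tmul]
      exact h3 _
    have h4 := congrArg (TensorProduct.comm ℤ (R ⧸ N) (Zmu e)) h1
    rw [map_zero] at h4
    rw [map_zero]
    exact h4
  rw [Submodule.mkQ_apply, Submodule.Quotient.mk_eq_zero] at h0
  obtain ⟨s, hs⟩ := h0
  have hs : n • s = r := by rw [← hs]; simp
  refine ⟨s, ?_⟩
  have : n • (baseInl e R s - x) = 0 := by
    rw [smul_sub, ← map_nsmul, hs, ← hr]
    exact sub_self _
  exact sub_eq_zero.1 (hinj.eq_zero_of_nsmul hn this)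

/-- Galois descent by traces. Write x as a sum of terms r ⊗ ζ ^ l with ζ of order n. By invariance,
the trace of ζ ^ j x is c_j x, and it lies in R because the traces c_j of the powers of ζ are
integers. The c_j generate an ideal containing n, so nx is in R, and n can be divided out by
`mem_range_of_nsmul_mem`. -/
theorem mem_range_of_galExt_eq (hinj : SteinitzTorsionFree e R) {x : ExtMu e R}
    (hx : ∀ τ : Zmu e ≃ₐ[ℤ] Zmu e, galExt R τ x = x) : x ∈ (baseInl e R).range := by
  obtain ⟨n, hn, hxn⟩ := exists_mem_cyclotomicPart x
  obtain ⟨ζ, hζ⟩ := exists_mu_orderOf_eq hn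
  obtain ⟨ι, _, τ, i₀, htr, hi₀⟩ := exists_trace_family ζ
  choose c hc using htr
  -- the elements `c j • x` lie in `R`
  have hmem : ∀ j, c j • x ∈ (baseInl e R).range := fun j => by
    have h1 : ∀ y ∈ cyclotomicPart e R n,
        ∑ i, galExt R (τ i) (extTmul (1 : ℤ) (muToZmu ζ ^ j) • y) ∈ (baseInl e R).range := by
      intro y hy
      refine AddSubgroup.closure_induction (p := fun y _ =>
        ∑ i, galExt R (τ i) (extTmul (1 : ℤ) (muToZmu ζ ^ j) • y) ∈ (baseInl e R).range)
        ?_ ?_ ?_ ?_ hy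
      · rintro _ ⟨r, z, hz, rfl⟩
        obtain ⟨l, rfl⟩ := exists_pow_of_orderOf_eq hn hζ hz
        simp only [extTmul_one_smul_extTmul, galExt_extTmul, muToZmu_pow, ← pow_add]
        rw [← extTmul_sum_right, hc, extTmul_intCast]
        exact ⟨_, rfl⟩
      · simp only [smul_zero, map_zero, Finset.sum_const_zero]
        exact zero_mem _
      · intro y z _ _ hy hz
        simp only [smul_add, map_add, Finset.sum_add_distrib]
        exact add_mem hy hz
      · intro y _ hy
        simp only [smul_neg, map_neg, Finset.sum_neg_distrib]
        exact neg_mem hy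
    have h2 := h1 x hxn
    simp only [galExt_smul, hx] at h2
    rw [← Finset.sum_smul] at h2
    have h3 : ∑ i, extTmul (1 : ℤ) (τ i (muToZmu ζ ^ j)) = (c j : ExtMu e ℤ) := by
      rw [← extTmul_sum_right, hc]
      exact map_intCast (Algebra.TensorProduct.includeRight : Zmu e →ₐ[ℤ] ℤ ⊗[ℤ] Zmu e) (c j)
    rwa [h3, Int.cast_smul_eq_zsmul] at h2
  -- the ideal generated by the `c j` contains `n`
  let I : Ideal ℤ :=
    { carrier := {m | m • x ∈ (baseInl e R).range}
      zero_mem' := by simp only [Set.mem_ofPred_eq, zero_smul]; exact zero_mem _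
      add_mem' := fun {a b} ha hb => by
        simp only [Set.mem_ofPred_eq] at ha hb ⊢
        rw [add_smul]; exact add_mem ha hb
      smul_mem' := fun a b hb => by
        simp only [Set.mem_ofPred_eq, smul_eq_mul] at hb ⊢
        rw [mul_smul]; exact zsmul_mem hb a }
  -- Orthogonality: the sum over j of (τ_i ζ / ζ) ^ j is n for i = i₀ and vanishes otherwise, being
  -- a geometric sum at a nontrivial n-th root of unity.
  have hsum : ∑ j ∈ Finset.range n, (c j : Zmu e) * muToZmu (ζ⁻¹ ^ j) = n := by
    have h1 : ∀ j, (c j : Zmu e) * muToZmu (ζ⁻¹ ^ j) =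
        ∑ i, (τ i (muToZmu ζ) * muToZmu ζ⁻¹) ^ j := fun j => by
      rw [← hc, Finset.sum_mul]
      refine Finset.sum_congr rfl fun i _ => ?_
      rw [map_pow, muToZmu_pow, mul_pow]
    simp only [h1]
    rw [Finset.sum_comm, Finset.sum_eq_single i₀]
    · rw [(hi₀ i₀).2 rfl, ← muToZmu_mul, mul_inv_cancel, muToZmu_one]
      simp
    · intro i _ hi
      have hζn : muToZmu ζ ^ n = 1 := by
        rw [← muToZmu_pow, ← hζ, pow_orderOf_eq_one, muToZmu_one]
      have hζn' : muToZmu ζ⁻¹ ^ n = 1 := by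
        rw [← muToZmu_pow, inv_pow, ← hζ, pow_orderOf_eq_one, inv_one, muToZmu_one]
      have h2 : (τ i (muToZmu ζ) * muToZmu ζ⁻¹) ^ n = 1 := by
        rw [mul_pow, ← map_pow, hζn, hζn', map_one, one_mul]
      have h3 : τ i (muToZmu ζ) * muToZmu ζ⁻¹ ≠ 1 := fun h => hi ((hi₀ i).1 (by
        have := congrArg (· * muToZmu ζ) h
        simpa [mul_assoc, ← muToZmu_mul, muToZmu_one] using this))
      have h4 := mul_geom_sum (τ i (muToZmu ζ) * muToZmu ζ⁻¹) n
      rw [h2, sub_self] at h4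
      exact (mul_eq_zero.1 h4).resolve_left (sub_ne_zero.2 h3)
    · simp
  -- The identity above places n in the extension of I to ℤ[μ_e]; faithful flatness contracts it
  -- back to I.
  have hnI : (n : ℤ) ∈ I := by
    rw [← Ideal.comap_map_eq_self_of_faithfullyFlat (B := Zmu e) I, Ideal.mem_comap, map_natCast,
      ← hsum]
    exact Ideal.sum_mem _ fun j _ => Ideal.mul_mem_right _ _
      (by simpa using Ideal.mem_map_of_mem (algebraMap ℤ (Zmu e)) (show c j ∈ I from hmem j))
  refine mem_range_of_nsmul_mem hinj hn ?_
  have : (n : ℤ) • x ∈ (baseInl e R).range := hnI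
  rwa [natCast_zsmul] at this

end Invariants

/-! ### Linear maps out of internal direct sums and push-forward of decompositions -/

section Lift

variable {ι : Type*} {k M N : Type*} [Ring k] [AddCommGroup M] [Module k M] [AddCommGroup N]
  [Module k N]

open Classical in
/-- The linear map on an internal direct sum with given restrictions to the components. -/
def internalLift {A : ι → Submodule k M} (h : IsDirect A) (f : ∀ i, A i →ₗ[k] N) :
    M →ₗ[k] N :=
  DirectSum.toModule k ι N f ∘ₗ (internalEquiv h).symm.toLinearMap

open Classical in
theorem internalLift_of_mem {A : ι → Submodule k M} (h : IsDirect A)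
    (f : ∀ i, A i →ₗ[k] N) {i : ι} {x : M} (hx : x ∈ A i) : internalLift h f x = f i ⟨x, hx⟩ := by
  simp [internalLift, internal_symm_of_mem h hx, DirectSum.toModule_lof]

open Classical in
/-- The push-forward of an internal direct sum decomposition along a map of the index sets. -/
theorem internal_iSup_fiber {κ : Type*} {A : ι → Submodule k M} (h : IsDirect A)
    (φ : ι → κ) : IsDirect fun j => ⨆ (i : ι) (_ : φ i = j), A i := by
  let q : κ → M →ₗ[k] M := fun j => internalLift h fun i => if φ i = j then (A i).subtype else 0
  have hq : ∀ j i, ∀ x ∈ A i, q j x = if φ i = j then x else 0 := fun j i x hx => by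
    simp only [q]
    rw [internalLift_of_mem h _ hx]
    split_ifs <;> rfl
  refine isDirect_of_proj q (fun j x hx => ?_) (fun j j' hne x hx => ?_) ?_
  · have hle : (⨆ (i : ι) (_ : φ i = j), A i) ≤ LinearMap.eqLocus (q j) LinearMap.id :=
      iSup₂_le fun i hi y hy => by
        rw [LinearMap.mem_eqLocus, hq j i y hy, if_pos hi]; rfl
    exact hle hx
  · have hle : (⨆ (i : ι) (_ : φ i = j), A i) ≤ LinearMap.ker (q j') :=
      iSup₂_le fun i hi y hy => by
        rw [LinearMap.mem_ker, hq j' i y hy, if_neg (hi ▸ hne)]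
    exact hle hx
  · rw [eq_top_iff, ← h.iSup_eq_top]
    exact iSup_le fun i => (le_iSup₂ (f := fun i' (_ : φ i' = φ i) => A i') i rfl).trans
      (le_iSup (fun j => ⨆ (i : ι) (_ : φ i = j), A i) (φ i))

end Lift

/-! ### Push-forward of gradings along group homomorphisms -/

section GradingMap

variable {k : Type*} [CommRing k] {R : Type*} [Ring R] [Algebra k R]

theorem IsGroupGrading.isDirect {Γ : Type*} [Group Γ] {𝒜 : Γ → Submodule k R}
    (h : IsGroupGrading 𝒜) : IsDirect 𝒜 := h.decomposition

theorem le_gradingMap {Γ Γ' : Type*} (φ : Γ → Γ') (𝒜 : Γ → Submodule k R) (γ : Γ) :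
    𝒜 γ ≤ gradingMap φ 𝒜 (φ γ) :=
  le_iSup₂ (f := fun g (_ : φ g = φ γ) => 𝒜 g) γ rfl

theorem gradingMap_le {Γ Γ' : Type*} {φ : Γ → Γ'} {𝒜 : Γ → Submodule k R}
    {ℬ : Γ' → Submodule k R} (h : ∀ γ, 𝒜 γ ≤ ℬ (φ γ)) (δ : Γ') : gradingMap φ 𝒜 δ ≤ ℬ δ :=
  iSup₂_le fun γ hγ => hγ ▸ h γ

theorem isGroupGrading_gradingMap {Γ Γ' : Type*} [Group Γ] [Group Γ'] {𝒜 : Γ → Submodule k R}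
    (h : IsGroupGrading 𝒜) (φ : Γ →* Γ') : IsGroupGrading (gradingMap φ 𝒜) where
  decomposition := internal_iSup_fiber h.isDirect φ
  one_mem := by
    have := le_gradingMap φ 𝒜 1 h.one_mem
    rwa [map_one] at this
  mul_mem := by
    intro g g' x y hx hy
    have h1 : ∀ γ, φ γ = g → ∀ x ∈ 𝒜 γ, x * y ∈ gradingMap φ 𝒜 (g * g') := by
      rintro γ rfl x hx
      have hle : gradingMap φ 𝒜 g' ≤
          (gradingMap φ 𝒜 (φ γ * g')).comap (LinearMap.mulLeft k x) := by
        refine iSup₂_le ?_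
        rintro γ' rfl z hz
        rw [Submodule.mem_comap, LinearMap.mulLeft_apply, ← map_mul]
        exact le_gradingMap φ 𝒜 _ (h.mul_mem hx hz)
      exact hle hy
    have hle : gradingMap φ 𝒜 g ≤ (gradingMap φ 𝒜 (g * g')).comap (LinearMap.mulRight k y) :=
      iSup₂_le fun γ hγ z hz => h1 γ hγ z hz
    exact hle hx

/-- A homomorphism that maps each component into the corresponding one is a morphism of
gradings. -/
theorem gradingMap_eq_of_le {Γ Γ' : Type*} [Group Γ] [Group Γ'] {𝒜 : Γ → Submodule k R}
    {ℬ : Γ' → Submodule k R} (h𝒜 : IsGroupGrading 𝒜) (hℬ : IsGroupGrading ℬ) {φ : Γ →* Γ'}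
    (h : ∀ γ, 𝒜 γ ≤ ℬ (φ γ)) : gradingMap φ 𝒜 = ℬ := by
  exact internal_eq_of_le (isGroupGrading_gradingMap h𝒜 φ).isDirect.iSup_eq_top
    hℬ.isDirect (gradingMap_le h)

end GradingMap

/-! ### Elements of `X_e(R)` and gradings by `μ_e` -/

section XSet

variable {e : Steinitz} {k : Type*} [CommRing k] {R : Type*} [Ring R] [Algebra k R]

theorem isMuDiagonalizable_iff {σ : AutExt e k R} :
    IsMuDiagonalizable σ ↔ IsDirect fun ζ : mu e => eigenExt σ ζ := by
  rw [IsMuDiagonalizable, IsDirect]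
  convert Iff.rfl
  rfl

/-- Every automorphism of ℤ[μ_e] comes from a unit a, so the quantifier over a can be dropped in
favour of all automorphisms. The converse, that every unit gives an automorphism, is not needed. -/
theorem mem_XSet_iff {σ : AutExt e k R} : σ ∈ XSet e k R ↔ IsMuDiagonalizable σ ∧
    ∀ (τ : Zmu e ≃ₐ[ℤ] Zmu e) (ζ : mu e), ∀ x ∈ eigenExt σ ζ,
      galExt R τ (σ ((galExt R τ).symm x)) = extTmul (1 : k) (τ (muToZmu ζ)) • x := by
  refine and_congr_right fun _ => ⟨fun h τ ζ x hx => ?_, fun h a τ hτ ζ x hx => ?_⟩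
  · obtain ⟨a, ha⟩ := exists_unit_muPow τ
    rw [h a τ ha ζ x hx, ha]
  · rw [h τ ζ x hx, hτ]

/-- With y = τ x, the twist τστ⁻¹ multiplies y by τ ζ, but multiplies the ξ-component of y by τ ξ.
For ξ ≠ ζ these scalars are distinct elements of μ_e, so that component vanishes. -/
theorem galExt_mem_eigenExt (hinj : SteinitzTorsionFree e R) {σ : AutExt e k R}
    (hσ : σ ∈ XSet e k R) (τ : Zmu e ≃ₐ[ℤ] Zmu e) {ζ : mu e} {x : ExtMu e R}
    (hx : x ∈ eigenExt σ ζ) : galExt R τ x ∈ eigenExt σ ζ := by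
  obtain ⟨hd, hτ⟩ := mem_XSet_iff.1 hσ
  rw [isMuDiagonalizable_iff] at hd
  set y := galExt R τ x with hy
  -- the twist `τ σ τ⁻¹` is linear and acts on `y` by `τ ζ`
  let T : ExtMu e R →+ ExtMu e R := ((galExt R τ).toAddMonoidHom.comp
    (σ : ExtMu e R →+ ExtMu e R)).comp (galExt R τ).symm.toAddMonoidHom
  have hT : ∀ z, T z = galExt R τ (σ ((galExt R τ).symm z)) := fun z => rfl
  have hTy : T y = extTmul (1 : k) (τ (muToZmu ζ)) • y := by
    rw [hT, hy, RingEquiv.symm_apply_apply, mem_eigenExt.1 hx, galExt_smul]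
  have hcomm : ∀ ξ z, internalProj hd ξ (T z) = extTmul (1 : k) (τ (muToZmu ξ)) •
      internalProj hd ξ z := fun ξ z => by
    refine internal_induction hd (P := fun z => internalProj hd ξ (T z) =
      extTmul (1 : k) (τ (muToZmu ξ)) • internalProj hd ξ z) (fun η z hz => ?_) (by simp)
      (fun z z' h h' => by rw [map_add, map_add, h, h', map_add, smul_add]) z
    rw [hT, hτ τ η z hz, map_smul]
    by_cases hne : η = ξ
    · rw [hne]
    · rw [internalProj_of_mem_ne hd hne hz, smul_zero, smul_zero]
  have hzero : ∀ ξ, ξ ≠ ζ → internalProj hd ξ y = 0 := fun ξ hne => by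
    have h1 := hcomm ξ y
    rw [hTy, map_smul] at h1
    obtain ⟨f, hf⟩ := exists_muHom τ.toAlgHom
    have hf : ∀ η, τ (muToZmu η) = muToZmu (f η) := hf
    rw [hf, hf] at h1
    refine hinj.eq_zero_of_smul_eq (k := k) (fun h => hne ?_) h1
    exact muToZmu_injective (τ.injective (by rw [hf, hf, h]))
  have : y = internalProj hd ζ y := by
    rw [← sub_eq_zero]
    refine internal_eq_zero hd fun ξ => ?_
    rw [map_sub]
    by_cases hne : ζ = ξ
    · subst hne
      rw [internalProj_of_mem hd (internalProj_mem hd ζ y), sub_self]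
    · rw [internalProj_of_mem_ne hd hne (internalProj_mem hd ζ y), sub_zero, hzero ξ (Ne.symm hne)]
  rw [this]
  exact internalProj_mem hd ζ y

theorem mul_mem_eigenBase {σ : AutExt e k R} {ζ ξ : mu e} {x y : R} (hx : x ∈ eigenBase σ ζ)
    (hy : y ∈ eigenBase σ ξ) : x * y ∈ eigenBase σ (ζ * ξ) := by
  rw [mem_eigenBase] at hx hy ⊢
  have : extTmul (x * y) (1 : Zmu e) = extTmul x 1 * extTmul y 1 := by
    rw [extTmul_mul, one_mul]
  rw [this, map_mul, hx, hy, extTmul_mul, muToZmu_mul]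

theorem one_mem_eigenBase (σ : AutExt e k R) : (1 : R) ∈ eigenBase σ 1 := by
  rw [mem_eigenBase, muToZmu_one, extTmul_one_one, map_one]

/-- The eigenspaces in `R` of an element of `X_e(R)` form a grading. -/
theorem isGroupGrading_eigenBase (hinj : SteinitzTorsionFree e R) {σ : AutExt e k R}
    (hσ : σ ∈ XSet e k R) : IsGroupGrading fun ζ : mu e => eigenBase σ ζ := by
  classical
  have hd := isMuDiagonalizable_iff.1 hσ.1
  -- Galois automorphisms preserve the eigenspaces, so they commute with the eigenprojections; the
  -- projections of x ⊗ 1 are invariant and descend to R.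
  have hproj : ∀ (ζ : mu e) (x : R), ∃ y : R, extTmul y 1 = internalProj hd ζ (extTmul x 1) := by
    intro ζ x
    refine mem_range_of_galExt_eq hinj fun τ => ?_
    have hcomm : ∀ z : ExtMu e R, galExt R τ (internalProj hd ζ z) =
        internalProj hd ζ (galExt R τ z) := fun z => by
      refine internal_induction hd (P := fun z => galExt R τ (internalProj hd ζ z) =
        internalProj hd ζ (galExt R τ z)) (fun η z hz => ?_) (by simp)
        (fun z z' h h' => by rw [map_add, map_add, h, h', map_add, map_add]) z
      have hz' := galExt_mem_eigenExt hinj hσ τ hz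
      by_cases hne : η = ζ
      · subst hne
        rw [internalProj_of_mem hd hz, internalProj_of_mem hd hz']
      · rw [internalProj_of_mem_ne hd hne hz, internalProj_of_mem_ne hd hne hz', map_zero]
    rw [hcomm, galExt_extTmul, map_one]
  choose q hq using hproj
  have hqmem : ∀ ζ x, q ζ x ∈ eigenBase σ ζ := fun ζ x => by
    rw [← extTmul_one_mem_eigenExt, hq]
    exact internalProj_mem hd ζ _
  have hinl := extTmul_left_injective (e := e) (R := R)
  let Q : mu e → R →ₗ[k] R := fun ζ =>
    { toFun := q ζ
      map_add' := fun x y => hinl (by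
        simp only [hq, extTmul_add_left, map_add])
      map_smul' := fun c x => hinl (by
        have h : ∀ y : R, extTmul (c • y) (1 : Zmu e) = extTmul c (1 : Zmu e) • extTmul y 1 :=
          fun y => by rw [extTmul_smul_extTmul, one_mul]
        simp only [hq, RingHom.id_apply, h, map_smul]) }
  have hQ : ∀ ζ x, Q ζ x = q ζ x := fun ζ x => rfl
  refine ⟨?_, one_mem_eigenBase σ, fun ζ ξ x y hx hy => mul_mem_eigenBase hx hy⟩
  have hmain := isDirect_of_proj (A := fun ζ : mu e => eigenBase σ ζ) Q (fun ζ x hx => hinl ?_)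
    (fun ζ ξ hne x hx => hinl ?_) ?_
  · exact hmain
  · simp only [hQ, hq]
    exact internalProj_of_mem hd (extTmul_one_mem_eigenExt.2 hx)
  · simp only [hQ, hq, extTmul_zero_left]
    exact internalProj_of_mem_ne hd hne (extTmul_one_mem_eigenExt.2 hx)
  · refine eq_top_iff.2 fun x _ => ?_
    obtain ⟨s, hs⟩ := exists_sum_internalProj hd (extTmul x 1)
    have : x = ∑ ζ ∈ s, q ζ x := hinl (by
      simp only [extTmul_sum_left, hq]
      exact (hs s subset_rfl).symm)
    rw [this]
    exact Submodule.sum_mem _ fun ζ _ => Submodule.mem_iSup_of_mem ζ (hqmem ζ x)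

open Classical in
-- Checked on tensors of homogeneous elements. It makes the base-extended projections of ℬ behave
-- like spectral projections of σ on R', although only containment in the eigenspaces over R is
-- assumed.
theorem commute_baseMap_internalProj {σ : AutExt e k R} {ℬ : mu e → Submodule k R}
    (hℬ : IsDirect ℬ) (hle : ∀ ζ, ℬ ζ ≤ eigenBase σ ζ) (ξ : mu e) (x : ExtMu e R) :
    σ (baseMap e (internalProj hℬ ξ) x) = baseMap e (internalProj hℬ ξ) (σ x) ∧
      baseMap e (internalProj hℬ ξ) (σ x) =
        extTmul (1 : k) (muToZmu ξ) • baseMap e (internalProj hℬ ξ) x := by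
  refine extTmul_induction (P := fun x => σ (baseMap e (internalProj hℬ ξ) x) =
    baseMap e (internalProj hℬ ξ) (σ x) ∧ baseMap e (internalProj hℬ ξ) (σ x) =
        extTmul (1 : k) (muToZmu ξ) • baseMap e (internalProj hℬ ξ) x) x
    (by simp) (fun y u => ?_) fun x y hx hy => by
      simp only [map_add, hx.1, hy.1, hx.2, hy.2, smul_add, true_and]
  refine internal_induction hℬ (P := fun y => σ (baseMap e (internalProj hℬ ξ) (extTmul y u)) =
    baseMap e (internalProj hℬ ξ) (σ (extTmul y u)) ∧
      baseMap e (internalProj hℬ ξ) (σ (extTmul y u)) =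
        extTmul (1 : k) (muToZmu ξ) • baseMap e (internalProj hℬ ξ) (extTmul y u))
    (fun ζ y hy => ?_) (by simp [extTmul_zero_left]) (fun x y hx hy => by
      simp only [extTmul_add_left, map_add, hx.1, hy.1, hx.2, hy.2, smul_add, true_and]) y
  rw [apply_extTmul_of_mem (hle ζ hy), baseMap_extTmul, baseMap_extTmul]
  by_cases hne : ζ = ξ
  · subst hne
    rw [internalProj_of_mem hℬ hy, apply_extTmul_of_mem (hle ζ hy), extTmul_one_smul_extTmul]
    exact ⟨rfl, rfl⟩
  · rw [internalProj_of_mem_ne hℬ hne hy]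
    simp [extTmul_zero_left]

open Classical in
theorem exists_sum_baseMap {ι : Type*} {ℬ : ι → Submodule k R} (hℬ : IsDirect ℬ)
    (x : ExtMu e R) :
    ∃ s : Finset ι, ∀ t, s ⊆ t → ∑ i ∈ t, baseMap e (internalProj hℬ i) x = x := by
  refine extTmul_induction (P := fun x => ∃ s : Finset ι, ∀ t, s ⊆ t →
    ∑ i ∈ t, baseMap e (internalProj hℬ i) x = x) x ⟨∅, by simp⟩ (fun y u => ?_) ?_
  · obtain ⟨s, hs⟩ := exists_sum_internalProj hℬ y
    refine ⟨s, fun t ht => ?_⟩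
    simp only [baseMap_extTmul]
    rw [← extTmul_sum_left, hs t ht]
  · rintro y z ⟨s, hs⟩ ⟨t, ht⟩
    refine ⟨s ∪ t, fun v hv => ?_⟩
    simp only [map_add, Finset.sum_add_distrib]
    rw [hs v (Finset.union_subset_left hv), ht v (Finset.union_subset_right hv)]

open Classical in
-- Applying σ scales the projection both by ζ and by ξ.
theorem eq_zero_of_mem_eigenExt (hinj : SteinitzTorsionFree e R) {σ : AutExt e k R}
    {ℬ : mu e → Submodule k R} (hℬ : IsDirect ℬ) (hle : ∀ ζ, ℬ ζ ≤ eigenBase σ ζ)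
    {ζ ξ : mu e} (hne : ζ ≠ ξ) {x : ExtMu e R} (hx : x ∈ eigenExt σ ζ) :
    baseMap e (internalProj hℬ ξ) x = 0 := by
  have h := (commute_baseMap_internalProj hℬ hle ξ x).2
  rw [mem_eigenExt.1 hx, map_smul] at h
  exact hinj.eq_zero_of_smul_eq (k := k) hne h

open Classical in
theorem baseMap_of_mem_eigenExt (hinj : SteinitzTorsionFree e R) {σ : AutExt e k R}
    {ℬ : mu e → Submodule k R} (hℬ : IsDirect ℬ) (hle : ∀ ζ, ℬ ζ ≤ eigenBase σ ζ)
    {ζ : mu e} {x : ExtMu e R} (hx : x ∈ eigenExt σ ζ) :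
    baseMap e (internalProj hℬ ζ) x = x := by
  obtain ⟨s, hs⟩ := exists_sum_baseMap hℬ x
  have h := hs (insert ζ s) (Finset.subset_insert ζ s)
  rwa [Finset.sum_eq_single ζ (fun ξ _ hne => eq_zero_of_mem_eigenExt hinj hℬ hle hne.symm hx)
    (fun h => (h (Finset.mem_insert_self ζ s)).elim)] at h

open Classical in
/-- An automorphism whose eigenspaces decompose `R` belongs to `X_e(R)`. -/
theorem mem_XSet_of_internal (hinj : SteinitzTorsionFree e R) {σ : AutExt e k R}
    {ℬ : mu e → Submodule k R} (hℬ : IsDirect ℬ) (hle : ∀ ζ, ℬ ζ ≤ eigenBase σ ζ) :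
    σ ∈ XSet e k R := by
  have hmem : ∀ ζ x, baseMap e (internalProj hℬ ζ) x ∈ eigenExt σ ζ := fun ζ x => by
    have := commute_baseMap_internalProj hℬ hle ζ x
    rw [mem_eigenExt, this.1, this.2]
  rw [mem_XSet_iff]
  refine ⟨isMuDiagonalizable_iff.2 <| isDirect_of_proj (fun ζ => baseMap e (internalProj hℬ ζ))
    (fun ζ x hx => baseMap_of_mem_eigenExt hinj hℬ hle hx)
    (fun ζ ξ hne x hx => eq_zero_of_mem_eigenExt hinj hℬ hle hne hx) ?_, fun τ ζ x hx => ?_⟩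
  · refine eq_top_iff.2 fun x _ => ?_
    obtain ⟨s, hs⟩ := exists_sum_baseMap hℬ x
    rw [← hs s subset_rfl]
    exact Submodule.sum_mem _ fun ζ _ => Submodule.mem_iSup_of_mem ζ (hmem ζ x)
  -- An eigenvector for ζ is a sum of tensors y ⊗ u with y in `ℬ ζ`. There τ moves only u, so τστ⁻¹
  -- multiplies by τ ζ.
  · rw [← baseMap_of_mem_eigenExt hinj hℬ hle hx]
    refine extTmul_induction (P := fun x => galExt R τ (σ ((galExt R τ).symm
      (baseMap e (internalProj hℬ ζ) x))) = extTmul (1 : k) (τ (muToZmu ζ)) •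
        baseMap e (internalProj hℬ ζ) x) x (by simp) (fun y u => ?_)
        fun x y hx hy => by simp only [map_add, hx, hy, smul_add]
    obtain ⟨v, rfl⟩ := τ.surjective u
    rw [baseMap_extTmul, ← galExt_extTmul, RingEquiv.symm_apply_apply,
      apply_extTmul_of_mem (hle ζ (internalProj_mem hℬ ζ y)), galExt_extTmul, galExt_extTmul,
      extTmul_one_smul_extTmul, map_mul]

open Classical in
theorem eq_of_eigenBase_le {σ σ' : AutExt e k R} {ℬ : mu e → Submodule k R}
    (hℬ : IsDirect ℬ) (h : ∀ ζ, ℬ ζ ≤ eigenBase σ ζ)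
    (h' : ∀ ζ, ℬ ζ ≤ eigenBase σ' ζ) : σ = σ' := by
  refine algEquiv_ext_extTmul fun x => ?_
  refine internal_induction hℬ (P := fun x => σ (extTmul x 1) = σ' (extTmul x 1))
    (fun ζ x hx => ?_) (by simp [extTmul_zero_left])
    (fun x y hx hy => by rw [extTmul_add_left, map_add, map_add, hx, hy]) x
  rw [mem_eigenBase.1 (h ζ hx), mem_eigenBase.1 (h' ζ hx)]

end XSet

/-! ### The automorphism attached to a grading and a character -/

section GradingAut

variable {e : Steinitz} {k : Type*} [CommRing k] {R : Type*} [Ring R] [Algebra k R]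
  {Γ : Type*} [Group Γ] {𝒜 : Γ → Submodule k R}

/-- Additive maps out of `R'` are determined by their values on tensors of homogeneous elements. -/
theorem IsDirect.ext_extTmul {ι : Type*} {𝒜 : ι → Submodule k R} (h : IsDirect 𝒜) {N : Type*}
    [AddCommMonoid N] {f g : ExtMu e R →+ N}
    (hfg : ∀ i, ∀ x ∈ 𝒜 i, ∀ u, f (extTmul x u) = g (extTmul x u)) : f = g := by
  refine AddMonoidHom.ext fun x => ?_
  refine extTmul_induction (P := fun x => f x = g x) x (by simp) (fun y u => ?_)
    fun x y hx hy => by rw [map_add, map_add, hx, hy]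
  exact internal_induction h (P := fun y => f (extTmul y u) = g (extTmul y u))
    (fun i x hx => hfg i x hx u) (by simp [extTmul_zero_left])
    (fun x y hx hy => by rw [extTmul_add_left, map_add, map_add, hx, hy]) y

/-- The coaction of the grading evaluated at χ: multiplicativity of χ matches multiplicativity of
the components. -/
theorem exists_gradingRingHom (h : IsGroupGrading 𝒜) (χ : Γ →* mu e) :
    ∃ α : R →+* R ⊗[ℤ] Zmu e, ∀ γ, ∀ x ∈ 𝒜 γ, α x = x ⊗ₜ muToZmu (χ γ) := by
  let α : R →ₗ[k] R ⊗[ℤ] Zmu e := internalLift h.isDirect fun γ =>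
    { toFun := fun x => (x : R) ⊗ₜ muToZmu (χ γ)
      map_add' := fun x y => by simp [TensorProduct.add_tmul]
      map_smul' := fun c x => by simp [TensorProduct.smul_tmul'] }
  have hα : ∀ γ, ∀ x ∈ 𝒜 γ, α x = x ⊗ₜ muToZmu (χ γ) := fun γ x hx =>
    internalLift_of_mem h.isDirect _ hx
  have hmul : ∀ x y, α (x * y) = α x * α y := fun x y => by
    refine internal_induction h.isDirect (P := fun x => α (x * y) = α x * α y) (fun γ x hx => ?_)
      (by simp) (fun x x' hx hx' => by rw [add_mul, map_add, map_add, add_mul, hx, hx']) x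
    refine internal_induction h.isDirect (P := fun y => α (x * y) = α x * α y) (fun δ y hy => ?_)
      (by simp) (fun y y' hy hy' => by rw [mul_add, map_add, map_add, mul_add, hy, hy']) y
    rw [hα _ _ hx, hα _ _ hy, hα _ _ (h.mul_mem hx hy), Algebra.TensorProduct.tmul_mul_tmul,
      map_mul, muToZmu_mul]
  have hone : α 1 = 1 := by
    rw [hα 1 1 h.one_mem, map_one, muToZmu_one]
    rfl
  let β : R →+* R ⊗[ℤ] Zmu e :=
    { toFun := α
      map_one' := hone
      map_mul' := hmul
      map_zero' := map_zero α
      map_add' := map_add α }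
  exact ⟨β, hα⟩

theorem exists_gradingHom (h : IsGroupGrading 𝒜) (χ : Γ →* mu e) :
    ∃ Φ : ExtMu e R →ₐ[ExtMu e k] ExtMu e R, ∀ γ, ∀ x ∈ 𝒜 γ, ∀ u,
      Φ (extTmul x u) = extTmul x (muToZmu (χ γ) * u) := by
  obtain ⟨α, hα⟩ := exists_gradingRingHom h χ
  let Ψ : R ⊗[ℤ] Zmu e →ₐ[ℤ] R ⊗[ℤ] Zmu e := Algebra.TensorProduct.lift α.toIntAlgHom
    Algebra.TensorProduct.includeRight (fun x u => by
      rw [commute_iff_eq]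
      refine internal_induction h.isDirect (P := fun x => α x *
        (Algebra.TensorProduct.includeRight u : R ⊗[ℤ] Zmu e) =
        (Algebra.TensorProduct.includeRight u : R ⊗[ℤ] Zmu e) * α x) (fun γ x hx => ?_)
        (by simp) (fun x y hx hy => by rw [map_add, add_mul, mul_add, hx, hy]) x
      rw [hα γ x hx, Algebra.TensorProduct.includeRight_apply,
        Algebra.TensorProduct.tmul_mul_tmul, Algebra.TensorProduct.tmul_mul_tmul, one_mul, mul_one,
        mul_comm])
  let Φ : ExtMu e R →+* ExtMu e R := Ψ.toRingHom
  have hΦ : ∀ γ, ∀ x ∈ 𝒜 γ, ∀ u, Φ (extTmul x u) = extTmul x (muToZmu (χ γ) * u) := by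
    intro γ x hx u
    have h1 : Ψ (x ⊗ₜ u) = x ⊗ₜ (muToZmu (χ γ) * u) := by
      have : Ψ (x ⊗ₜ u) = α x * (1 ⊗ₜ u) := Algebra.TensorProduct.lift_tmul _ _ _ _ _
      rw [this, hα γ x hx, Algebra.TensorProduct.tmul_mul_tmul, mul_one]
    exact h1
  have hk : ∀ (c : ExtMu e k) (x : ExtMu e R), Φ (c • x) = c • Φ x := fun c x => by
    let f : ExtMu e R →+ ExtMu e R := Φ.toAddMonoidHom.comp (DistribSMul.toAddMonoidHom _ c)
    let g : ExtMu e R →+ ExtMu e R := (DistribSMul.toAddMonoidHom _ c).comp Φ.toAddMonoidHom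
    suffices hfg : f = g from DFunLike.congr_fun hfg x
    refine h.isDirect.ext_extTmul fun γ x hx u => ?_
    change Φ (c • extTmul x u) = c • Φ (extTmul x u)
    refine extTmul_induction (P := fun c => Φ (c • extTmul x u) = c • Φ (extTmul x u)) c (by simp)
      (fun a v => ?_) fun a b ha hb => by rw [add_smul, map_add, ha, hb, add_smul]
    rw [extTmul_smul_extTmul, hΦ γ _ ((𝒜 γ).smul_mem a hx), hΦ γ x hx, extTmul_smul_extTmul,
      mul_left_comm]
  exact ⟨AlgHom.mk' Φ hk, hΦ⟩

/-- The endomorphism of `R'` that acts on the component at `γ` as multiplication by `χ γ`. -/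
def gradingHom (h : IsGroupGrading 𝒜) (χ : Γ →* mu e) : ExtMu e R →ₐ[ExtMu e k] ExtMu e R :=
  Classical.choose (exists_gradingHom h χ)

theorem gradingHom_extTmul (h : IsGroupGrading 𝒜) (χ : Γ →* mu e) {γ : Γ} {x : R} (hx : x ∈ 𝒜 γ)
    (u : Zmu e) : gradingHom h χ (extTmul x u) = extTmul x (muToZmu (χ γ) * u) :=
  Classical.choose_spec (exists_gradingHom h χ) γ x hx u

theorem gradingHom_mul (h : IsGroupGrading 𝒜) (χ ψ : Γ →* mu e) :
    gradingHom h (χ * ψ) = (gradingHom h χ).comp (gradingHom h ψ) := by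
  have : (gradingHom h (χ * ψ) : ExtMu e R →+ ExtMu e R) =
      ((gradingHom h χ).comp (gradingHom h ψ) : ExtMu e R →ₐ[ExtMu e k] ExtMu e R) := by
    refine h.isDirect.ext_extTmul fun γ x hx u => ?_
    change gradingHom h (χ * ψ) (extTmul x u) = gradingHom h χ (gradingHom h ψ (extTmul x u))
    rw [gradingHom_extTmul h _ hx, gradingHom_extTmul h _ hx, gradingHom_extTmul h _ hx,
      MonoidHom.mul_apply, muToZmu_mul, mul_assoc]
  exact AlgHom.ext fun x => DFunLike.congr_fun this x

theorem gradingHom_one (h : IsGroupGrading 𝒜) :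
    gradingHom h (1 : Γ →* mu e) = AlgHom.id (ExtMu e k) (ExtMu e R) := by
  have : (gradingHom h (1 : Γ →* mu e) : ExtMu e R →+ ExtMu e R) =
      (AlgHom.id (ExtMu e k) (ExtMu e R) : ExtMu e R →ₐ[ExtMu e k] ExtMu e R) := by
    refine h.isDirect.ext_extTmul fun γ x hx u => ?_
    change gradingHom h 1 (extTmul x u) = extTmul x u
    rw [gradingHom_extTmul h _ hx, MonoidHom.one_apply, muToZmu_one, one_mul]
  exact AlgHom.ext fun x => DFunLike.congr_fun this x

/-- The automorphism of `R'` that acts on the component at `γ` as multiplication by `χ γ`. -/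
def gradingAut (h : IsGroupGrading 𝒜) : (Γ →* mu e) →* AutExt e k R where
  toFun χ := AlgEquiv.ofAlgHom (gradingHom h χ) (gradingHom h χ⁻¹)
    (by rw [← gradingHom_mul, mul_inv_cancel, gradingHom_one])
    (by rw [← gradingHom_mul, inv_mul_cancel, gradingHom_one])
  map_one' := AlgEquiv.ext fun x => by
    rw [AlgEquiv.ofAlgHom_apply, gradingHom_one]; rfl
  map_mul' χ ψ := AlgEquiv.ext fun x => by
    rw [AlgEquiv.ofAlgHom_apply, gradingHom_mul]; rfl

theorem gradingAut_extTmul (h : IsGroupGrading 𝒜) (χ : Γ →* mu e) {γ : Γ} {x : R} (hx : x ∈ 𝒜 γ)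
    (u : Zmu e) : gradingAut h χ (extTmul x u) = extTmul x (muToZmu (χ γ) * u) :=
  gradingHom_extTmul h χ hx u

theorem le_eigenBase_gradingAut (h : IsGroupGrading 𝒜) (χ : Γ →* mu e) (γ : Γ) :
    𝒜 γ ≤ eigenBase (gradingAut h χ) (χ γ) := fun x hx => by
  rw [mem_eigenBase, gradingAut_extTmul h χ hx, mul_one]

theorem gradingMap_le_eigenBase_gradingAut (h : IsGroupGrading 𝒜) (χ : Γ →* mu e) (ζ : mu e) :
    gradingMap χ 𝒜 ζ ≤ eigenBase (gradingAut h χ) ζ :=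
  gradingMap_le (ℬ := fun ζ => eigenBase (gradingAut h χ) ζ) (le_eigenBase_gradingAut h χ) ζ

theorem gradingAut_mem_XSet (hinj : SteinitzTorsionFree e R) (h : IsGroupGrading 𝒜)
    (χ : Γ →* mu e) : gradingAut h χ ∈ XSet e k R :=
  mem_XSet_of_internal hinj (isGroupGrading_gradingMap h χ).isDirect
    (gradingMap_le_eigenBase_gradingAut h χ)

/-- An element of `X_e(R)` is determined by its eigenspaces in `R`. -/
theorem eq_gradingAut (h : IsGroupGrading 𝒜)
    {σ : AutExt e k R} {χ : Γ →* mu e} (hχ : ∀ γ, 𝒜 γ ≤ eigenBase σ (χ γ)) :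
    σ = gradingAut h χ :=
  eq_of_eigenBase_le (isGroupGrading_gradingMap h χ).isDirect
    (gradingMap_le (ℬ := fun ζ => eigenBase σ ζ) hχ) (gradingMap_le_eigenBase_gradingAut h χ)

end GradingAut

/-! ### From a universal grading to a compact group -/

section Compact

variable {e : Steinitz} {k : Type*} [CommRing k] {R : Type*} [Ring R] [Algebra k R]

theorem isSteinitzTorsion_mu (e : Steinitz) : IsSteinitzTorsion e (mu e) := mu_stDvd

theorem isSteinitzTorsion_ulift {Γ : Type*} [Group Γ] (h : IsSteinitzTorsion e Γ) :
    IsSteinitzTorsion e (ULift.{w} Γ) := fun γ => by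
  rw [← MulEquiv.orderOf_eq MulEquiv.ulift γ]
  exact h _

theorem finite_pow_eq_one {n : ℕ} (hn : StDvd n e) : {ζ : mu e | ζ ^ n = 1}.Finite := by
  obtain ⟨g, hg⟩ := exists_mu_orderOf_eq hn
  refine (Set.finite_range fun j : Fin n => g ^ (j : ℕ)).subset fun ζ hζ => ?_
  obtain ⟨j, rfl⟩ := exists_pow_of_orderOf_eq hn hg hζ
  refine ⟨⟨j % n, Nat.mod_lt _ (Nat.pos_of_ne_zero hn.1)⟩, ?_⟩
  change g ^ (j % n) = g ^ j
  rw [← pow_mod_orderOf g j, hg]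

/-- Homomorphisms Γ → μ_e form a closed subset of a product of finite sets, the factor at γ being
the roots of unity killed by the order of γ. The map to automorphisms is continuous because its
value at a homogeneous tensor depends on one coordinate. -/
theorem isCompact_range_gradingAut {Γ : Type*} [Group Γ] {𝒜 : Γ → Submodule k R}
    (h : IsGroupGrading 𝒜) (htor : IsSteinitzTorsion e Γ) :
    IsCompact (Set.range (gradingAut h (e := e))) := by
  let _ : TopologicalSpace (mu e) := ⊥
  have hdisc : DiscreteTopology (mu e) := ⟨rfl⟩
  let K : Set (Γ → mu e) :=
    Set.pi Set.univ fun γ => {ζ : mu e | ζ ^ orderOf γ = 1}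
  have hK : IsCompact K := isCompact_univ_pi fun γ => (finite_pow_eq_one (htor γ)).isCompact
  let H : Set (Γ → mu e) :=
    {f | ∀ γ δ, f (γ * δ) = f γ * f δ}
  have hH : IsClosed H := by
    simp only [H, Set.ofPred_forall]
    refine isClosed_iInter fun γ => isClosed_iInter fun δ => ?_
    refine isClosed_eq (continuous_apply _) ?_
    have hγ : Continuous fun f : Γ → mu e => f γ := continuous_apply γ
    have hδ : Continuous fun f : Γ → mu e => f δ := continuous_apply δ
    exact hγ.mul hδ
  have hKH : IsCompact (K ∩ H) := hK.inter_right hH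
  let toHom : ↥(K ∩ H) → (Γ →* mu e) := fun f => MonoidHom.mk' (f : Γ → mu e) f.2.2
  have hcont : Continuous fun f => gradingAut h (toHom f) := by
    rw [continuous_induced_rng]
    let _ : TopologicalSpace (ExtMu e R) := ⊥
    have : DiscreteTopology (ExtMu e R) := ⟨rfl⟩
    refine continuous_pi fun x => ?_
    change Continuous fun f => gradingAut h (toHom f) x
    refine extTmul_induction (P := fun x => Continuous fun f => gradingAut h (toHom f) x) x
      (by simpa using continuous_const) (fun y u => ?_) fun x y hx hy => by
        simp only [map_add]
        exact hx.add hy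
    refine internal_induction h.isDirect (P := fun y => Continuous fun f =>
      gradingAut h (toHom f) (extTmul y u)) (fun γ y hy => ?_)
      (by simpa [extTmul_zero_left] using continuous_const) (fun x y hx hy => by
        simp only [map_add, extTmul_add_left]
        exact hx.add hy) y
    simp only [gradingAut_extTmul h _ hy]
    have hd : Continuous fun ζ : mu e => extTmul y (muToZmu ζ * u) :=
      continuous_of_discreteTopology
    have hγ : Continuous fun f : ↥(K ∩ H) => (f : Γ → mu e) γ :=
      (continuous_apply γ).comp continuous_subtype_val
    exact hd.comp hγ
  have : CompactSpace ↥(K ∩ H) := isCompact_iff_compactSpace.1 hKH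
  have hrange := isCompact_range hcont
  convert hrange using 1
  ext σ
  constructor
  · rintro ⟨χ, rfl⟩
    refine ⟨⟨χ, fun γ _ => ?_, fun γ δ => map_mul χ γ δ⟩, rfl⟩
    change χ γ ^ orderOf γ = 1
    rw [← map_pow, pow_orderOf_eq_one, map_one]
  · rintro ⟨f, rfl⟩
    exact ⟨_, rfl⟩

/-- If `R` has a universal grading then `X_e(R)` is the group of characters of the universal
group. -/
theorem range_gradingAut_eq_XSet {k : Type s} [CommRing k] {R : Type r} [Ring R] [Algebra k R]
    (hinj : SteinitzTorsionFree e R) {Υ : Type t} [CommGroup Υ]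
    {𝒰 : Υ → Submodule k R} (h : IsUniversalGrading.{w} e 𝒰) :
    Set.range (gradingAut h.grading (e := e)) = XSet e k R := by
  refine Set.Subset.antisymm ?_ fun σ hσ => ?_
  · rintro _ ⟨χ, rfl⟩
    exact gradingAut_mem_XSet hinj h.grading χ
  -- The universal property, applied to the μ_e-grading given by σ, produces the character φ through
  -- which σ acts on 𝒰. The lift only moves μ_e into the universe over which initiality is
  -- quantified.
  · let ι : mu e →* ULift.{w} (mu e) := MulEquiv.ulift.symm.toMonoidHom
    have h1 := isGroupGrading_gradingMap (isGroupGrading_eigenBase hinj hσ) ι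
    obtain ⟨φ, hφ, -⟩ := h.initial (ULift.{w} (mu e))
      (isSteinitzTorsion_ulift (isSteinitzTorsion_mu e)) _ h1
    refine ⟨MulEquiv.ulift.toMonoidHom.comp φ, (eq_gradingAut h.grading fun γ => ?_).symm⟩
    refine (le_gradingMap φ 𝒰 γ).trans ?_
    rw [hφ]
    refine iSup₂_le fun ζ hζ => ?_
    have : MulEquiv.ulift.toMonoidHom.comp φ γ = ζ := congrArg ULift.down hζ.symm
    rw [this]

theorem exists_compact_of_universal {k : Type s} [CommRing k] {R : Type r} [Ring R] [Algebra k R]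
    (hinj : SteinitzTorsionFree e R) {Υ : Type t} [CommGroup Υ]
    {𝒰 : Υ → Submodule k R} (h : IsUniversalGrading.{w} e 𝒰) :
    ∃ Δ : Subgroup (AutExt e k R), (Δ : Set (AutExt e k R)) = XSet e k R ∧
      IsCompact (Δ : Set (AutExt e k R)) ∧ ∀ σ ∈ Δ, ∀ τ ∈ Δ, σ * τ = τ * σ := by
  refine ⟨(gradingAut h.grading (e := e)).range, ?_, ?_, ?_⟩
  · rw [MonoidHom.coe_range, range_gradingAut_eq_XSet hinj h]
  · rw [MonoidHom.coe_range]
    exact isCompact_range_gradingAut h.grading h.torsion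
  · rintro _ ⟨χ, rfl⟩ _ ⟨ψ, rfl⟩
    rw [← map_mul, ← map_mul, mul_comm]

end Compact

/-! ### Characters of abelian groups -/

section Characters

/-- Duality for finite abelian groups: a character that vanishes wherever finitely many characters
with finite range vanish lies in the subgroup that they generate. -/
theorem mem_closure_range_of_forall_eq_one {D : Type*} [Group D] {ι : Type*} [Finite ι]
    (c : ι → D →* Circle) (hfin : ∀ i, (Set.range (c i)).Finite) (χ : D →* Circle)
    (h : ∀ d, (∀ i, c i d = 1) → χ d = 1) : χ ∈ Subgroup.closure (Set.range c) := by
  -- The finite group to which duality applies is the joint image of the characters; χ factors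
  -- through it by hypothesis.
  let P : D →* (ι → Circle) := MonoidHom.pi c
  have hG : Finite P.range := by
    refine Set.Finite.subset (Set.Finite.pi' hfin) ?_
    rintro _ ⟨d, rfl⟩ i
    exact ⟨d, rfl⟩
  let χ' : P.range →* Circle := P.rangeRestrict.liftOfSurjective P.rangeRestrict_surjective
    ⟨χ, fun d hd => h d fun i => by
      have h1 : P d = 1 := by
        rw [MonoidHom.mem_ker] at hd
        exact congrArg Subtype.val hd
      exact congrFun h1 i⟩
  have hχ' : ∀ d, χ' (P.rangeRestrict d) = χ d := fun d =>
    MonoidHom.liftOfRightInverse_comp_apply _ _ _ _ d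
  let coord : ι → (P.range →* Circleˣ) := fun i =>
    (toUnits : Circle ≃* Circleˣ).toMonoidHom.comp ((Pi.evalMonoidHom _ i).comp P.range.subtype)
  let Φ : Subgroup (P.range →* Circleˣ) := Subgroup.closure (Set.range coord)
  have : NeZero (Monoid.exponent P.range) := ⟨Monoid.exponent_ne_zero_of_finite⟩
  -- An element on which all coordinates are trivial is 1, so the coordinate characters have trivial
  -- annihilator and generate the full dual.
  have hΦ : Φ = ⊤ := by
    let I := CommGroup.subgroupOrderIsoSubgroupMonoidHom P.range Circle
    have h1 : I.symm (OrderDual.toDual Φ) = ⊥ := by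
      rw [eq_bot_iff]
      intro g hg
      rw [CommGroup.mem_subgroupOrderIsoSubgroupMonoidHom_symm_iff] at hg
      rw [Subgroup.mem_bot]
      refine Subtype.ext (funext fun i => ?_)
      exact (MulEquiv.map_eq_one_iff toUnits).1
        (hg (coord i) (Subgroup.subset_closure ⟨i, rfl⟩))
    have h2 : OrderDual.toDual Φ = I ⊥ := by rw [← h1, OrderIso.apply_symm_apply]
    rw [eq_top_iff]
    intro φ _
    have h3 : φ ∈ (I ⊥).ofDual := by
      rw [CommGroup.mem_subgroupOrderIsoSubgroupMonoidHom_iff]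
      intro g hg
      rw [Subgroup.mem_bot.1 hg, map_one]
    rwa [← h2] at h3
  have key : ∀ φ ∈ Φ, ((toUnits : Circle ≃* Circleˣ).symm.toMonoidHom.comp φ).comp P.rangeRestrict ∈
      Subgroup.closure (Set.range c) := fun φ hφ => by
    refine Subgroup.closure_induction (p := fun φ _ =>
      ((toUnits : Circle ≃* Circleˣ).symm.toMonoidHom.comp φ).comp P.rangeRestrict ∈
        Subgroup.closure (Set.range c)) ?_ ?_ ?_ ?_ hφ
    · rintro _ ⟨i, rfl⟩
      exact Subgroup.subset_closure ⟨i, rfl⟩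
    · exact one_mem _
    · intro φ ψ _ _ h1 h2
      convert mul_mem h1 h2 using 1
      ext d
      simp
    · intro φ _ h1
      convert inv_mem h1 using 1
      ext d
      simp
  have h4 := key ((toUnits : Circle ≃* Circleˣ).toMonoidHom.comp χ') (hΦ ▸ Subgroup.mem_top _)
  convert h4 using 1
  ext d
  simp [hχ']

/-- Characters with values in `μ_e` separate the points of an abelian `e`-torsion group. -/
theorem exists_character_ne_one {e : Steinitz} {Γ : Type*} [CommGroup Γ]
    (htor : IsSteinitzTorsion e Γ) {γ : Γ} (hγ : γ ≠ 1) : ∃ ψ : Γ →* mu e, ψ γ ≠ 1 := by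
  obtain ⟨c, hc⟩ := CharacterModule.exists_character_apply_ne_zero_of_ne_zero
    (A := Additive Γ) (a := Additive.ofMul γ) hγ
  -- The separating character has values in ℚ/ℤ; it is carried into the circle through the embedding
  -- of ℚ/ℤ in ℝ/ℤ. Torsion of Γ then puts its values in μ_e.
  let j : AddCircle (1 : ℚ) →+ AddCircle (1 : ℝ) :=
    QuotientAddGroup.map _ _ ((Rat.castHom ℝ : ℚ →+* ℝ) : ℚ →+ ℝ) (by
      rw [AddSubgroup.zmultiples_le]
      exact ⟨1, by simp⟩)
  have hj : Function.Injective j := by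
    rw [injective_iff_map_eq_zero]
    intro q hq
    induction q using QuotientAddGroup.induction_on with
    | H q =>
      have h1 : ((q : ℝ) : AddCircle (1 : ℝ)) = 0 := hq
      rw [AddCircle.coe_eq_zero_iff] at h1
      obtain ⟨n, hn⟩ := h1
      refine (AddCircle.coe_eq_zero_iff (1 : ℚ)).2 ⟨n, ?_⟩
      have h2 : ((n : ℚ) : ℝ) = q := by simpa using hn
      have h3 : (n : ℚ) = q := Rat.cast_injective h2
      rw [zsmul_one, h3]
  let f : Γ →* Circle :=
    { toFun := fun x => AddCircle.toCircle (j (c (Additive.ofMul x)))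
      map_one' := by simp
      map_mul' := fun x y => by simp [AddCircle.toCircle_add] }
  have hf : ∀ x, f x ∈ mu e := fun x =>
    mem_mu_of_pow_eq_one (htor x) (by rw [← map_pow, pow_orderOf_eq_one, map_one])
  refine ⟨f.codRestrict (mu e) hf, fun h => hc ?_⟩
  have h1 : AddCircle.toCircle (j (c (Additive.ofMul γ))) = 1 := congrArg Subtype.val h
  rw [← AddCircle.toCircle_zero (T := (1 : ℝ))] at h1
  have h2 := AddCircle.injective_toCircle one_ne_zero h1
  exact hj (h2.trans (map_zero j).symm)

theorem exists_pow_eq_one_of_finite {e : Steinitz} {T : Set Circle} (hT : T.Finite)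
    (h : ∀ z ∈ T, z ∈ mu e) : ∃ n, StDvd n e ∧ ∀ z ∈ T, z ^ n = 1 := by
  induction T, hT using Set.Finite.induction_on with
  | empty => exact ⟨1, StDvd.one e, by simp⟩
  | @insert a T _ _ ih =>
    obtain ⟨n, hn, hn'⟩ := ih fun z hz => h z (Set.mem_insert_of_mem a hz)
    have ha : StDvd (orderOf a) e := h a (Set.mem_insert a T)
    refine ⟨_, ha.lcm hn, ?_⟩
    rintro z (rfl | hz)
    · exact orderOf_dvd_iff_pow_eq_one.1 (Nat.dvd_lcm_left _ _)
    · obtain ⟨l, hl⟩ := Nat.dvd_lcm_right (orderOf a) n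
      rw [hl, pow_mul, hn' z hz, one_pow]

end Characters

/-! ### The topology on the automorphism group -/

section Topology

variable {e : Steinitz} {k : Type*} [CommRing k] {R : Type*} [Ring R] [Algebra k R]

/-- Evaluation at a point is continuous for the discrete topology on `R'`. -/
theorem continuous_aut_apply (x : ExtMu e R) :
    @Continuous (AutExt e k R) (ExtMu e R) _ ⊥ fun σ => σ x := by
  let _ : TopologicalSpace (ExtMu e R) := ⊥
  have h1 : Continuous fun σ : AutExt e k R => (σ : ExtMu e R → ExtMu e R) :=
    continuous_induced_dom
  exact (continuous_apply x).comp h1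

theorem isOpen_setOf_apply_eq (x y : ExtMu e R) : IsOpen {σ : AutExt e k R | σ x = y} := by
  let _ : TopologicalSpace (ExtMu e R) := ⊥
  have : DiscreteTopology (ExtMu e R) := ⟨rfl⟩
  exact (isOpen_discrete {y}).preimage (continuous_aut_apply x)

theorem exists_finset_subset_of_mem_nhds {σ : AutExt e k R} {U : Set (AutExt e k R)}
    (hU : U ∈ nhds σ) : ∃ F : Finset (ExtMu e R), ∀ τ : AutExt e k R, (∀ x ∈ F, τ x = σ x) → τ ∈ U := by
  let _ : TopologicalSpace (ExtMu e R) := ⊥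
  have : DiscreteTopology (ExtMu e R) := ⟨rfl⟩
  rw [nhds_induced, Filter.mem_comap] at hU
  obtain ⟨V, hV, hVU⟩ := hU
  rw [nhds_pi, Filter.mem_pi] at hV
  obtain ⟨I, hI, t, ht, htV⟩ := hV
  refine ⟨hI.toFinset, fun τ hτ => hVU (htV fun x hx => ?_)⟩
  change τ x ∈ t x
  rw [hτ x (hI.mem_toFinset.2 hx)]
  exact mem_of_mem_nhds (ht x)

/-- The orbit is a continuous image of a compact set in a discrete space. -/
theorem finite_orbit {Δ : Subgroup (AutExt e k R)} (hc : IsCompact (Δ : Set (AutExt e k R)))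
    (x : ExtMu e R) : (Set.range fun δ : Δ => (δ : AutExt e k R) x).Finite := by
  let _ : TopologicalSpace (ExtMu e R) := ⊥
  have : DiscreteTopology (ExtMu e R) := ⟨rfl⟩
  have h1 := (hc.image (continuous_aut_apply x)).finite_of_discrete
  refine h1.subset ?_
  rintro _ ⟨δ, rfl⟩
  exact ⟨δ, δ.2, rfl⟩

/-- A function on `Δ` that depends only on the values at finitely many points is continuous. -/
theorem continuous_of_forall_eq {Δ : Subgroup (AutExt e k R)} {α : Type*} [TopologicalSpace α]
    {f : Δ → α} (x : ExtMu e R)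
    (h : ∀ δ δ' : Δ, (δ : AutExt e k R) x = (δ' : AutExt e k R) x → f δ = f δ') : Continuous f := by
  refine IsLocallyConstant.continuous ((IsLocallyConstant.iff_eventually_eq f).2 fun δ => ?_)
  have h1 : {σ : AutExt e k R | σ x = (δ : AutExt e k R) x} ∈ nhds (δ : AutExt e k R) :=
    (isOpen_setOf_apply_eq x _).mem_nhds rfl
  filter_upwards [continuous_subtype_val.continuousAt.preimage_mem_nhds h1] with δ' hδ'
  exact h δ' δ hδ'

/-- A continuous character depends only on the values at finitely many points. -/
theorem exists_finset_forall_eq_one {Δ : Subgroup (AutExt e k R)} (χ : PontryaginDual Δ) :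
    ∃ F : Finset (ExtMu e R), ∀ δ : Δ, (∀ x ∈ F, (δ : AutExt e k R) x = x) → χ δ = 1 := by
  have hcont : Continuous χ := map_continuous χ
  -- The circle has no small subgroups: an element all of whose powers stay in this arc is 1. If δ
  -- fixes F pointwise, so do its powers, and χ sends them all into the arc.
  have hV : IsOpen (Circle.centeredArc (Real.pi / 2)) := Circle.isOpen_centeredArc _
  have h1 : (1 : Circle) ∈ Circle.centeredArc (Real.pi / 2) := by
    rw [Circle.mem_centeredArc (by linarith [Real.pi_pos])]
    simp [Real.pi_pos]
  have h2 : χ ⁻¹' Circle.centeredArc (Real.pi / 2) ∈ nhds (1 : Δ) :=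
    hcont.continuousAt.preimage_mem_nhds (by rw [map_one]; exact hV.mem_nhds h1)
  rw [nhds_subtype, Filter.mem_comap] at h2
  obtain ⟨U, hU, hUV⟩ := h2
  obtain ⟨F, hF⟩ := exists_finset_subset_of_mem_nhds hU
  refine ⟨F, fun δ hδ => Circle.eq_one_of_forall_pow_mem_centeredArc_pi_div_two fun n h0 => ?_⟩
  clear h0
  rw [← map_pow]
  refine hUV (hF _ fun x hx => ?_)
  rw [Subgroup.coe_pow, Subgroup.coe_one, AlgEquiv.one_apply]
  clear hUV hU
  induction n with
  | zero => simp
  | succ n ih => rw [pow_succ, AlgEquiv.mul_apply, hδ x hx, ih]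

/-- Finitely many eigenvalues are involved, each of order dividing e; n is a common multiple of the
orders. -/
theorem exists_pow_apply_eq {σ : AutExt e k R} (hσ : IsMuDiagonalizable σ) (F : Finset (ExtMu e R)) :
    ∃ n, StDvd n e ∧ ∀ x ∈ F, (σ ^ n) x = x := by
  have hpow : ∀ {m n : ℕ} {x : ExtMu e R}, m ∣ n → (σ ^ m) x = x → (σ ^ n) x = x := by
    rintro m _ x ⟨l, rfl⟩ hx
    rw [pow_mul]
    induction l with
    | zero => simp
    | succ l ih => rw [pow_succ, AlgEquiv.mul_apply, hx, ih]
  have h1 : ∀ x, ∃ n, StDvd n e ∧ (σ ^ n) x = x := fun x => by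
    refine internal_induction (isMuDiagonalizable_iff.1 hσ)
      (P := fun x => ∃ n, StDvd n e ∧ (σ ^ n) x = x) (fun ζ x hx => ?_) ⟨1, StDvd.one e, by simp⟩ ?_ x
    · refine ⟨orderOf ζ, mu_stDvd ζ, ?_⟩
      have : ∀ n : ℕ, (σ ^ n) x = extTmul (1 : k) (muToZmu (ζ ^ n)) • x := fun n => by
        induction n with
        | zero => rw [pow_zero, pow_zero, muToZmu_one, extTmul_one_one, one_smul]; rfl
        | succ n ih =>
          rw [pow_succ, AlgEquiv.mul_apply, mem_eigenExt.1 hx, map_smul, ih,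
            extTmul_one_smul_smul, ← muToZmu_mul, pow_succ, mul_comm]
      rw [this, pow_orderOf_eq_one, muToZmu_one, extTmul_one_one, one_smul]
    · rintro x y ⟨m, hm, hx⟩ ⟨n, hn, hy⟩
      exact ⟨_, hm.lcm hn, by rw [map_add, hpow (Nat.dvd_lcm_left m n) hx,
        hpow (Nat.dvd_lcm_right m n) hy]⟩
  classical
  induction F using Finset.induction_on with
  | empty => exact ⟨1, StDvd.one e, by simp⟩
  | insert a F _ ih =>
    obtain ⟨m, hm, ha⟩ := h1 a
    obtain ⟨n, hn, hF⟩ := ih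
    refine ⟨_, hm.lcm hn, fun x hx => ?_⟩
    rcases Finset.mem_insert.1 hx with rfl | hx
    · exact hpow (Nat.dvd_lcm_left m n) ha
    · exact hpow (Nat.dvd_lcm_right m n) (hF x hx)

/-- Continuous characters of a group of `μ_e`-diagonalizable automorphisms have values in `μ_e`. -/
theorem character_mem_mu {Δ : Subgroup (AutExt e k R)}
    (hΔ : ∀ σ ∈ Δ, IsMuDiagonalizable σ) (χ : PontryaginDual Δ) (δ : Δ) : χ δ ∈ mu e := by
  obtain ⟨F, hF⟩ := exists_finset_forall_eq_one χ
  obtain ⟨n, hn, hn'⟩ := exists_pow_apply_eq (hΔ δ δ.2) F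
  exact mem_mu_of_pow_eq_one hn (by rw [← map_pow]; exact hF _ hn')

/-- By `exists_finset_forall_eq_one`, χ δ is determined by the values of δ on a finite set, and
orbits are finite. -/
theorem finite_range_character {Δ : Subgroup (AutExt e k R)}
    (hc : IsCompact (Δ : Set (AutExt e k R))) (χ : PontryaginDual Δ) : (Set.range χ).Finite := by
  obtain ⟨F, hF⟩ := exists_finset_forall_eq_one χ
  have h1 : (Set.range fun (δ : Δ) (x : F) => (δ : AutExt e k R) x).Finite := by
    refine (Set.Finite.pi' fun x : F => finite_orbit hc (x : ExtMu e R)).subset ?_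
    rintro _ ⟨δ, rfl⟩ x
    exact ⟨δ, rfl⟩
  have h2 : ∀ δ δ' : Δ, (fun x : F => (δ : AutExt e k R) x) =
      (fun x : F => (δ' : AutExt e k R) x) → χ δ = χ δ' := fun δ δ' h => by
    have h3 : χ (δ'⁻¹ * δ) = 1 := hF _ fun x hx => by
      rw [Subgroup.coe_mul, AlgEquiv.mul_apply, congrFun h ⟨x, hx⟩, ← AlgEquiv.mul_apply,
        ← Subgroup.coe_mul, inv_mul_cancel]
      rfl
    rw [map_mul, map_inv, inv_mul_eq_one] at h3
    exact h3.symm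
  obtain ⟨g, hg⟩ : ∃ g : (F → ExtMu e R) → Circle, ∀ δ : Δ,
      χ δ = g fun x : F => (δ : AutExt e k R) x := by
    classical
    refine ⟨fun v => if h : ∃ δ : Δ, (fun x : F => (δ : AutExt e k R) x) = v then
      χ h.choose else 1, fun δ => ?_⟩
    have h : ∃ δ' : Δ, (fun x : F => (δ' : AutExt e k R) x) = fun x : F => (δ : AutExt e k R) x :=
      ⟨δ, rfl⟩
    simp only
    rw [dif_pos h]
    exact h2 _ _ h.choose_spec.symm
  refine (h1.image g).subset ?_
  rintro _ ⟨δ, rfl⟩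
  exact ⟨_, ⟨δ, rfl⟩, (hg δ).symm⟩

/-- Evaluation of the continuous characters, as a homomorphism. -/
def pontryaginDualCoe (D : Type*) [Monoid D] [TopologicalSpace D] :
    PontryaginDual D →* (D →* Circle) where
  toFun χ := (χ : D →* Circle)
  map_one' := rfl
  map_mul' _ _ := rfl

theorem pontryaginDual_pow_apply {D : Type*} [Monoid D] [TopologicalSpace D]
    (χ : PontryaginDual D) (n : ℕ) (d : D) : (χ ^ n) d = χ d ^ n :=
  DFunLike.congr_fun (map_pow (pontryaginDualCoe D) χ n) d

theorem isSteinitzTorsion_pontryaginDual {Δ : Subgroup (AutExt e k R)}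
    (hΔ : ∀ σ ∈ Δ, IsMuDiagonalizable σ) (hc : IsCompact (Δ : Set (AutExt e k R))) :
    IsSteinitzTorsion e (PontryaginDual Δ) := fun χ => by
  obtain ⟨n, hn, hn'⟩ := exists_pow_eq_one_of_finite (e := e) (finite_range_character hc χ)
    (by rintro _ ⟨δ, rfl⟩; exact character_mem_mu hΔ χ δ)
  refine hn.of_dvd (orderOf_dvd_of_pow_eq_one (PontryaginDual.ext fun δ => ?_))
  rw [pontryaginDual_pow_apply]
  exact hn' _ ⟨δ, rfl⟩

end Topology

/-! ### Joint eigenspaces -/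

section Joint

variable {e : Steinitz} {k : Type*} [CommRing k] {R : Type*} [Ring R] [Algebra k R]

theorem isDirect_eigenBase (hinj : SteinitzTorsionFree e R) {σ : AutExt e k R}
    (hσ : σ ∈ XSet e k R) : IsDirect fun ζ : mu e => eigenBase σ ζ :=
  (isGroupGrading_eigenBase hinj hσ).isDirect

theorem eigenBase_index_unique (hinj : SteinitzTorsionFree e R) {σ : AutExt e k R} {ζ ξ : mu e}
    {x : R} (hx : x ≠ 0) (h1 : x ∈ eigenBase σ ζ) (h2 : x ∈ eigenBase σ ξ) : ζ = ξ := by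
  by_contra hne
  exact hx (extTmul_eq_zero_of_ne hinj hne (h1.symm.trans h2))

/-- The base extension of an eigenprojection of `σ` commutes with every `τ` that commutes with
`σ`. -/
theorem apply_baseMap_internalProj (hinj : SteinitzTorsionFree e R) {σ τ : AutExt e k R}
    (hσ : σ ∈ XSet e k R) (hcomm : σ * τ = τ * σ) (ζ : mu e) (x : ExtMu e R) :
    τ (baseMap e (internalProj (isDirect_eigenBase hinj hσ) ζ) x) =
      baseMap e (internalProj (isDirect_eigenBase hinj hσ) ζ) (τ x) := by
  have hd := isDirect_eigenBase hinj hσ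
  have hle : ∀ ζ, (fun ζ : mu e => eigenBase σ ζ) ζ ≤ eigenBase σ ζ := fun ζ => le_rfl
  refine internal_induction (isMuDiagonalizable_iff.1 hσ.1)
    (P := fun x => τ (baseMap e (internalProj hd ζ) x) = baseMap e (internalProj hd ζ) (τ x))
    (fun η z hz => ?_) (by simp) (fun x y hx hy => by simp only [map_add, hx, hy]) x
  -- An automorphism commuting with σ preserves its eigenspaces.
  have hz' : τ z ∈ eigenExt σ η := by
    rw [mem_eigenExt, ← AlgEquiv.mul_apply, hcomm, AlgEquiv.mul_apply, mem_eigenExt.1 hz, map_smul]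
  by_cases hne : η = ζ
  · subst hne
    rw [baseMap_of_mem_eigenExt hinj hd hle hz, baseMap_of_mem_eigenExt hinj hd hle hz']
  · rw [eq_zero_of_mem_eigenExt hinj hd hle hne hz, eq_zero_of_mem_eigenExt hinj hd hle hne hz',
      map_zero]

/-- The inductive step of simultaneous diagonalization: splitting a τ-eigenvector along σ leaves
τ-eigenvectors. -/
theorem internalProj_mem_eigenBase (hinj : SteinitzTorsionFree e R) {σ τ : AutExt e k R}
    (hσ : σ ∈ XSet e k R) (hcomm : σ * τ = τ * σ) (ζ : mu e) {ξ : mu e} {x : R}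
    (hx : x ∈ eigenBase τ ξ) :
    internalProj (isDirect_eigenBase hinj hσ) ζ x ∈ eigenBase τ ξ := by
  have h := apply_baseMap_internalProj hinj hσ hcomm ζ (extTmul x 1)
  rw [mem_eigenBase.1 hx, baseMap_extTmul, baseMap_extTmul] at h
  exact h

variable {Δ : Subgroup (AutExt e k R)}

theorem mem_eigenBase_mul {δ δ' : AutExt e k R} {ζ ξ : mu e} {x : R} (h : x ∈ eigenBase δ ζ)
    (h' : x ∈ eigenBase δ' ξ) : x ∈ eigenBase (δ * δ') (ζ * ξ) := by
  rw [mem_eigenBase, AlgEquiv.mul_apply, mem_eigenBase.1 h', apply_extTmul_of_mem h, muToZmu_mul]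

/-- A common eigenvector lies in one of the joint eigenspaces. -/
theorem exists_mem_jointEigen (hinj : SteinitzTorsionFree e R) {x : R}
    (hx : ∀ δ : Δ, ∃ ζ : mu e, x ∈ eigenBase (δ : AutExt e k R) ζ) :
    ∃ χ : PontryaginDual Δ, x ∈ jointEigen Δ χ := by
  by_cases h0 : x = 0
  · exact ⟨1, h0 ▸ zero_mem _⟩
  choose c hc using hx
  have hmul : ∀ δ δ', c (δ * δ') = c δ * c δ' := fun δ δ' =>
    eigenBase_index_unique hinj h0 (hc (δ * δ')) (mem_eigenBase_mul (hc δ) (hc δ'))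
  let f : Δ →* Circle := (mu e).subtype.comp (MonoidHom.mk' c hmul)
  -- The eigenvalue is recovered from δ(x ⊗ 1) because x is nonzero, so it is locally constant in δ.
  have hf : Continuous f := continuous_of_forall_eq (extTmul x 1) fun δ δ' h => by
    have : c δ = c δ' := eigenBase_index_unique hinj h0 (hc δ)
      (show (δ : AutExt e k R) (extTmul x 1) = _ from h.trans (hc δ'))
    exact congrArg Subtype.val this
  refine ⟨(⟨f, hf⟩ : Δ →ₜ* Circle), ?_⟩
  simp only [jointEigen, Submodule.mem_iInf]
  intro δ ζ hζ
  have : ζ = c δ := Subtype.ext hζ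
  rw [this]
  exact hc δ

/-- Compactness reduces the diagonalization of x under Δ to finitely many commuting automorphisms,
one for each point of the finite orbit of x ⊗ 1. -/
theorem iSup_jointEigen (hinj : SteinitzTorsionFree e R)
    (hΔ : (Δ : Set (AutExt e k R)) = XSet e k R) (hc : IsCompact (Δ : Set (AutExt e k R)))
    (hcomm : ∀ σ ∈ Δ, ∀ τ ∈ Δ, σ * τ = τ * σ) : ⨆ χ : PontryaginDual Δ, jointEigen Δ χ = ⊤ := by
  have hX : ∀ δ : Δ, (δ : AutExt e k R) ∈ XSet e k R := fun δ => hΔ ▸ δ.2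
  refine eq_top_iff.2 fun x _ => ?_
  -- The second condition, that y is fixed by whatever fixes x, survives the projections and later
  -- controls the automorphisms outside T.
  let S : Finset Δ → Set R := fun T => {y | (∀ t ∈ T, ∃ ζ : mu e, y ∈ eigenBase (t : AutExt e k R) ζ) ∧
    ∀ δ : Δ, x ∈ eigenBase (δ : AutExt e k R) 1 → y ∈ eigenBase (δ : AutExt e k R) 1}
  have hS : ∀ T : Finset Δ, x ∈ Submodule.span k (S T) := fun T => by
    classical
    induction T using Finset.induction_on with
    | empty => exact Submodule.subset_span ⟨by simp, fun δ h => h⟩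
    | insert t T _ ih =>
      refine Submodule.span_le.2 (fun y hy => ?_) ih
      have hd := isDirect_eigenBase hinj (hX t)
      obtain ⟨s, hs⟩ := exists_sum_internalProj hd y
      rw [SetLike.mem_coe, ← hs s subset_rfl]
      refine Submodule.sum_mem _ fun ζ _ => Submodule.subset_span ⟨fun t' ht' => ?_, fun δ hδ => ?_⟩
      · rcases Finset.mem_insert.1 ht' with rfl | ht'
        · exact ⟨ζ, internalProj_mem hd ζ y⟩
        · obtain ⟨ξ, hξ⟩ := hy.1 t' ht'
          exact ⟨ξ, internalProj_mem_eigenBase hinj (hX t) (hcomm _ t.2 _ t'.2) ζ hξ⟩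
      · exact internalProj_mem_eigenBase hinj (hX t) (hcomm _ t.2 _ δ.2) ζ (hy.2 δ hδ)
  obtain ⟨T, hT⟩ : ∃ T : Finset Δ, ∀ δ : Δ, ∃ t ∈ T,
      (δ : AutExt e k R) (extTmul x 1) = (t : AutExt e k R) (extTmul x 1) := by
    classical
    let f : Δ → ExtMu e R := fun δ => (δ : AutExt e k R) (extTmul x 1)
    have hfin := (finite_orbit hc (extTmul x 1)).fintype
    let g : Set.range f → Δ := Function.surjInv Set.rangeFactorization_surjective
    refine ⟨Finset.univ.image g, fun δ => ⟨g ⟨f δ, δ, rfl⟩, Finset.mem_image_of_mem g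
      (Finset.mem_univ _), ?_⟩⟩
    exact (congrArg Subtype.val (Function.surjInv_eq Set.rangeFactorization_surjective
      (⟨f δ, δ, rfl⟩ : Set.range f))).symm
  refine Submodule.span_le.2 (fun y hy => ?_) (hS T)
  have hy' : ∀ δ : Δ, ∃ ζ : mu e, y ∈ eigenBase (δ : AutExt e k R) ζ := fun δ => by
    obtain ⟨t, ht, hδt⟩ := hT δ
    obtain ⟨ζ, hζ⟩ := hy.1 t ht
    refine ⟨ζ, ?_⟩
    -- Since δ and t agree on x ⊗ 1, the quotient t⁻¹δ fixes x and hence y; thus δ acts on y as t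
    -- does.
    have h1 : x ∈ eigenBase ((t⁻¹ * δ : Δ) : AutExt e k R) 1 := by
      rw [mem_eigenBase, Subgroup.coe_mul, AlgEquiv.mul_apply, hδt, ← AlgEquiv.mul_apply,
        ← Subgroup.coe_mul, inv_mul_cancel, muToZmu_one]
      rfl
    have h2 := mem_eigenBase_mul hζ (hy.2 _ h1)
    rwa [← Subgroup.coe_mul, mul_inv_cancel_left, mul_one] at h2
  obtain ⟨χ, hχ⟩ := exists_mem_jointEigen hinj hy'
  exact Submodule.mem_iSup_of_mem χ hχ

theorem mem_jointEigen_iff {χ : PontryaginDual Δ} {x : R} : x ∈ jointEigen Δ χ ↔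
    ∀ (δ : Δ) (ζ : mu e), (ζ : Circle) = χ δ → x ∈ eigenBase (δ : AutExt e k R) ζ := by
  simp only [jointEigen, Submodule.mem_iInf]

theorem exists_mem_eigenBase_of_mem_jointEigen (hΔ : ∀ σ ∈ Δ, IsMuDiagonalizable σ)
    {χ : PontryaginDual Δ} {x : R} (hx : x ∈ jointEigen Δ χ) (δ : Δ) :
    ∃ ζ : mu e, (ζ : Circle) = χ δ ∧ x ∈ eigenBase (δ : AutExt e k R) ζ :=
  ⟨⟨χ δ, character_mem_mu hΔ χ δ⟩, rfl, mem_jointEigen_iff.1 hx δ _ rfl⟩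

/-- Induction on the number of terms: choose δ separating χ from another χ' in the sum and project
to the eigenspace of δ for χ δ. The χ-term survives and the χ'-term drops out. -/
theorem eq_zero_of_sum_jointEigen (hinj : SteinitzTorsionFree e R)
    (hX : ∀ δ ∈ Δ, δ ∈ XSet e k R) (y : PontryaginDual Δ → R) :
    ∀ (n : ℕ) (s : Finset (PontryaginDual Δ)), s.card = n → (∀ χ ∈ s, y χ ∈ jointEigen Δ χ) →
      ∑ χ ∈ s, y χ = 0 → ∀ χ ∈ s, y χ = 0 := by
  classical
  intro n
  induction n using Nat.strong_induction_on with
  | _ n ih =>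
    intro s hs hy hsum χ hχ
    by_cases hsub : ∃ χ' ∈ s, χ' ≠ χ
    · obtain ⟨χ', hχ', hne⟩ := hsub
      obtain ⟨δ, hδ⟩ : ∃ δ, χ' δ ≠ χ δ := by
        by_contra! h
        exact hne (PontryaginDual.ext h)
      have hd := isDirect_eigenBase hinj (hX δ δ.2)
      obtain ⟨ζ, hζ, -⟩ := exists_mem_eigenBase_of_mem_jointEigen (fun σ h => (hX σ h).1)
        (hy χ hχ) δ
      have h1 : ∑ ψ ∈ s with ψ δ = χ δ, y ψ = 0 := by
        have h2 := congrArg (internalProj hd ζ) hsum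
        rw [map_sum, map_zero] at h2
        rw [Finset.sum_filter]
        refine (Finset.sum_congr rfl fun ψ hψ => ?_).trans h2
        obtain ⟨ξ, hξ, hmem⟩ := exists_mem_eigenBase_of_mem_jointEigen (fun σ h => (hX σ h).1)
          (hy ψ hψ) δ
        split_ifs with heq
        · have : ξ = ζ := Subtype.ext (hξ.trans (heq.trans hζ.symm))
          subst this
          exact (internalProj_of_mem hd hmem).symm
        · have : ξ ≠ ζ := fun h => heq (hξ.symm.trans ((congrArg Subtype.val h).trans hζ))
          exact (internalProj_of_mem_ne hd this hmem).symm
      refine ih _ ?_ _ rfl (fun ψ hψ => hy ψ (Finset.mem_filter.1 hψ).1) h1 χ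
        (Finset.mem_filter.2 ⟨hχ, rfl⟩)
      rw [← hs]
      refine Finset.card_lt_card (Finset.filter_ssubset.2 ⟨χ', hχ', hδ⟩)
    · push Not at hsub
      rwa [Finset.sum_eq_single_of_mem χ hχ fun ψ hψ hne => (hne (hsub ψ hψ)).elim] at hsum

/-- The joint eigenspaces form a grading by the group of continuous characters. -/
theorem isGroupGrading_jointEigen (hinj : SteinitzTorsionFree e R)
    (hΔ : (Δ : Set (AutExt e k R)) = XSet e k R) (hc : IsCompact (Δ : Set (AutExt e k R)))
    (hcomm : ∀ σ ∈ Δ, ∀ τ ∈ Δ, σ * τ = τ * σ) :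
    IsGroupGrading fun χ : PontryaginDual Δ => jointEigen Δ χ := by
  classical
  have hX : ∀ δ ∈ Δ, δ ∈ XSet e k R := fun δ hδ => hΔ ▸ hδ
  have hD : ∀ σ ∈ Δ, IsMuDiagonalizable σ := fun σ hσ => (hX σ hσ).1
  refine ⟨?_, mem_jointEigen_iff.2 fun δ ζ hζ => ?_, fun χ ψ x y hx hy =>
    mem_jointEigen_iff.2 fun δ ζ hζ => ?_⟩
  · refine isDirect_iff.2 (DirectSum.isInternal_submodule_of_iSupIndep_of_iSup_eq_top ?_
      (iSup_jointEigen hinj hΔ hc hcomm))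
    rw [iSupIndep_iff_finsetSum_eq_zero_imp_eq_zero]
    intro s y hy hsum χ hχ
    exact eq_zero_of_sum_jointEigen hinj hX y _ s rfl hy hsum χ hχ
  · have : ζ = 1 := Subtype.ext (hζ.trans (PontryaginDual.one_apply δ))
    rw [this]
    exact one_mem_eigenBase _
  · obtain ⟨ζ₁, h1, h1'⟩ := exists_mem_eigenBase_of_mem_jointEigen hD hx δ
    obtain ⟨ζ₂, h2, h2'⟩ := exists_mem_eigenBase_of_mem_jointEigen hD hy δ
    have : ζ = ζ₁ * ζ₂ := Subtype.ext (by
      rw [hζ, Subgroup.coe_mul, h1, h2]; rfl)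
    rw [this]
    exact mul_mem_eigenBase h1' h2'

/-! ### The universal property -/

/-- An element of `R'` is fixed by every automorphism on which the characters of finitely many
nonzero joint eigenspaces are trivial. -/
theorem exists_finset_character (hinj : SteinitzTorsionFree e R)
    (hΔ : (Δ : Set (AutExt e k R)) = XSet e k R) (hc : IsCompact (Δ : Set (AutExt e k R)))
    (hcomm : ∀ σ ∈ Δ, ∀ τ ∈ Δ, σ * τ = τ * σ) (F : Finset (ExtMu e R)) :
    ∃ C : Finset (PontryaginDual Δ), (∀ ψ ∈ C, jointEigen Δ ψ ≠ ⊥) ∧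
      ∀ δ : Δ, (∀ ψ ∈ C, ψ δ = 1) → ∀ x ∈ F, (δ : AutExt e k R) x = x := by
  classical
  have hunion : ∀ {p q : Δ → Prop},
      (∃ C : Finset (PontryaginDual Δ), (∀ ψ ∈ C, jointEigen Δ ψ ≠ ⊥) ∧
        ∀ δ : Δ, (∀ ψ ∈ C, ψ δ = 1) → p δ) →
      (∃ C : Finset (PontryaginDual Δ), (∀ ψ ∈ C, jointEigen Δ ψ ≠ ⊥) ∧
        ∀ δ : Δ, (∀ ψ ∈ C, ψ δ = 1) → q δ) →
      ∃ C : Finset (PontryaginDual Δ), (∀ ψ ∈ C, jointEigen Δ ψ ≠ ⊥) ∧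
        ∀ δ : Δ, (∀ ψ ∈ C, ψ δ = 1) → p δ ∧ q δ := by
    rintro p q ⟨C, hC, hp⟩ ⟨D, hD, hq⟩
    refine ⟨C ∪ D, fun ψ hψ => (Finset.mem_union.1 hψ).elim (hC ψ) (hD ψ), fun δ h =>
      ⟨hp δ fun ψ hψ => h ψ (Finset.mem_union_left D hψ),
        hq δ fun ψ hψ => h ψ (Finset.mem_union_right C hψ)⟩⟩
  have hsingle : ∀ x : ExtMu e R, ∃ C : Finset (PontryaginDual Δ),
      (∀ ψ ∈ C, jointEigen Δ ψ ≠ ⊥) ∧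
        ∀ δ : Δ, (∀ ψ ∈ C, ψ δ = 1) → (δ : AutExt e k R) x = x := fun x => by
    have hadd : ∀ x y : ExtMu e R, (∃ C : Finset (PontryaginDual Δ),
      (∀ ψ ∈ C, jointEigen Δ ψ ≠ ⊥) ∧
        ∀ δ : Δ, (∀ ψ ∈ C, ψ δ = 1) → (δ : AutExt e k R) x = x) →
      (∃ C : Finset (PontryaginDual Δ), (∀ ψ ∈ C, jointEigen Δ ψ ≠ ⊥) ∧
        ∀ δ : Δ, (∀ ψ ∈ C, ψ δ = 1) → (δ : AutExt e k R) y = y) →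
      (∃ C : Finset (PontryaginDual Δ), (∀ ψ ∈ C, jointEigen Δ ψ ≠ ⊥) ∧
        ∀ δ : Δ, (∀ ψ ∈ C, ψ δ = 1) → (δ : AutExt e k R) (x + y) = x + y) := fun x y hx hy => by
      obtain ⟨C, hC, h⟩ := hunion hx hy
      exact ⟨C, hC, fun δ hδ => by rw [map_add, (h δ hδ).1, (h δ hδ).2]⟩
    refine extTmul_induction (P := fun x => ∃ C : Finset (PontryaginDual Δ),
      (∀ ψ ∈ C, jointEigen Δ ψ ≠ ⊥) ∧
        ∀ δ : Δ, (∀ ψ ∈ C, ψ δ = 1) → (δ : AutExt e k R) x = x) x ⟨∅, by simp, by simp⟩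
      (fun y u => ?_) hadd
    refine internal_induction (isGroupGrading_jointEigen hinj hΔ hc hcomm).isDirect
      (P := fun y => ∃ C : Finset (PontryaginDual Δ), (∀ ψ ∈ C, jointEigen Δ ψ ≠ ⊥) ∧
        ∀ δ : Δ, (∀ ψ ∈ C, ψ δ = 1) → (δ : AutExt e k R) (extTmul y u) = extTmul y u)
      (fun χ y hy => ?_) ⟨∅, by simp, by simp [extTmul_zero_left]⟩
      (fun x y hx hy => by rw [extTmul_add_left]; exact hadd _ _ hx hy) y
    -- For y = 0 the empty set is used, so that only characters with nonzero eigenspace ever enter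
    -- C.
    by_cases h0 : y = 0
    · exact ⟨∅, by simp, by simp [h0, extTmul_zero_left]⟩
    · refine ⟨{χ}, fun ψ hψ hbot => ?_, fun δ hδ => ?_⟩
      · rw [Finset.mem_singleton.1 hψ] at hbot
        rw [hbot] at hy
        exact h0 hy
      · have h1 := mem_jointEigen_iff.1 hy δ 1 (hδ χ (Finset.mem_singleton_self χ)).symm
        rw [apply_extTmul_of_mem h1, muToZmu_one, one_mul]
  induction F using Finset.induction_on with
  | empty => exact ⟨∅, by simp, by simp⟩
  | insert a F _ ih =>
    obtain ⟨C, hC, h⟩ := hunion (hsingle a) ih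
    refine ⟨C, hC, fun δ hδ x hx => ?_⟩
    rcases Finset.mem_insert.1 hx with rfl | hx
    · exact (h δ hδ).1
    · exact (h δ hδ).2 x hx

/-- The characters of the nonzero joint eigenspaces generate the dual group. -/
theorem closure_support_jointEigen (hinj : SteinitzTorsionFree e R)
    (hΔ : (Δ : Set (AutExt e k R)) = XSet e k R) (hc : IsCompact (Δ : Set (AutExt e k R)))
    (hcomm : ∀ σ ∈ Δ, ∀ τ ∈ Δ, σ * τ = τ * σ) :
    Subgroup.closure {χ : PontryaginDual Δ | jointEigen Δ χ ≠ ⊥} = ⊤ := by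
  refine eq_top_iff.2 fun χ _ => ?_
  obtain ⟨F, hF⟩ := exists_finset_forall_eq_one χ
  obtain ⟨C, hC, h⟩ := exists_finset_character hinj hΔ hc hcomm F
  -- Where the characters in C are trivial, δ fixes F pointwise, so χ is trivial too; finite duality
  -- puts χ in the subgroup generated by C.
  have h1 := mem_closure_range_of_forall_eq_one (fun ψ : C => pontryaginDualCoe Δ ψ)
    (fun ψ => finite_range_character hc ψ) (pontryaginDualCoe Δ χ)
    fun δ hδ => hF δ (h δ fun ψ hψ => hδ ⟨ψ, hψ⟩)
  have h2 : Set.range (fun ψ : C => pontryaginDualCoe Δ ψ) = pontryaginDualCoe Δ '' C := by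
    ext f; simp
  rw [h2, ← MonoidHom.map_closure] at h1
  obtain ⟨χ', hχ', heq⟩ := h1
  have h3 : χ' = χ := PontryaginDual.ext fun δ => DFunLike.congr_fun heq δ
  rw [← h3]
  exact Subgroup.closure_mono hC hχ'

theorem apply_baseMap_gradingAut {Γ : Type*} [Group Γ] {𝒜 : Γ → Submodule k R}
    (h : IsGroupGrading 𝒜) (ψ : Γ →* mu e) (γ : Γ) (x : ExtMu e R) :
    gradingAut h ψ (baseMap e (internalProj h.isDirect γ) x) =
      baseMap e (internalProj h.isDirect γ) (gradingAut h ψ x) := by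
  let f : ExtMu e R →+ ExtMu e R := (gradingAut h ψ : ExtMu e R →+ ExtMu e R).comp
    (baseMap e (internalProj h.isDirect γ)).toAddMonoidHom
  let g : ExtMu e R →+ ExtMu e R := (baseMap e (internalProj h.isDirect γ)).toAddMonoidHom.comp
    (gradingAut h ψ : ExtMu e R →+ ExtMu e R)
  suffices hfg : f = g from DFunLike.congr_fun hfg x
  refine h.isDirect.ext_extTmul fun γ' x hx u => ?_
  change gradingAut h ψ (baseMap e (internalProj h.isDirect γ) (extTmul x u)) =
      baseMap e (internalProj h.isDirect γ) (gradingAut h ψ (extTmul x u))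
  rw [gradingAut_extTmul h ψ hx, baseMap_extTmul, baseMap_extTmul]
  by_cases hne : γ' = γ
  · subst hne
    rw [internalProj_of_mem h.isDirect hx, gradingAut_extTmul h ψ hx]
  · rw [internalProj_of_mem_ne h.isDirect hne hx, extTmul_zero_left, extTmul_zero_left, map_zero]

/-- `γ` corresponds to `χ` if `ψ γ` is the value of `χ` at the automorphism attached to `ψ`, for all
characters `ψ`. -/
def Corresponds {Γ : Type*} [Group Γ] {𝒜 : Γ → Submodule k R} (h : IsGroupGrading 𝒜)
    (χ : PontryaginDual Δ) (γ : Γ) : Prop :=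
  ∀ (ψ : Γ →* mu e) (δ : Δ), (δ : AutExt e k R) = gradingAut h ψ → χ δ = (ψ γ : Circle)

section Universal

variable {Γ : Type*} [CommGroup Γ] {𝒜 : Γ → Submodule k R}

/-- Every ψ yields an element of Δ, so ψ γ is prescribed for all ψ, and characters into μ_e separate
the points of Γ. -/
theorem Corresponds.unique (hinj : SteinitzTorsionFree e R)
    (hΔ : (Δ : Set (AutExt e k R)) = XSet e k R) (htor : IsSteinitzTorsion e Γ)
    (h : IsGroupGrading 𝒜) {χ : PontryaginDual Δ} {γ γ' : Γ} (h1 : Corresponds h χ γ)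
    (h2 : Corresponds h χ γ') : γ = γ' := by
  by_contra hne
  have hne' : γ * γ'⁻¹ ≠ 1 := fun h => hne (mul_inv_eq_one.1 h)
  obtain ⟨ψ, hψ⟩ := exists_character_ne_one htor hne'
  have hmem : gradingAut h ψ ∈ Δ := by
    rw [← SetLike.mem_coe, hΔ]; exact gradingAut_mem_XSet hinj h ψ
  have h3 : ψ γ = ψ γ' :=
    Subtype.ext ((h1 ψ ⟨_, hmem⟩ rfl).symm.trans (h2 ψ ⟨_, hmem⟩ rfl))
  exact hψ (by rw [map_mul, map_inv, h3, mul_inv_cancel])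

/-- The γ-component of x is an eigenvector of δ_ψ with eigenvalue χ(δ_ψ), since projections commute
with δ_ψ, and with eigenvalue ψ γ, since it is homogeneous. Being nonzero, it has only one
eigenvalue. -/
theorem corresponds_of_internalProj_ne_zero (hinj : SteinitzTorsionFree e R)
    (hD : ∀ σ ∈ Δ, IsMuDiagonalizable σ) (h : IsGroupGrading 𝒜) {χ : PontryaginDual Δ} {x : R}
    (hx : x ∈ jointEigen Δ χ) {γ : Γ} (hγ : internalProj h.isDirect γ x ≠ 0) :
    Corresponds h χ γ := by
  intro ψ δ hδ
  obtain ⟨ζ, hζ, hmem⟩ := exists_mem_eigenBase_of_mem_jointEigen hD hx δ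
  rw [← hζ]
  rw [hδ] at hmem
  have h1 := apply_baseMap_gradingAut h ψ γ (extTmul x 1)
  rw [mem_eigenBase.1 hmem, baseMap_extTmul, baseMap_extTmul] at h1
  have h2 := le_eigenBase_gradingAut h ψ γ (internalProj_mem h.isDirect γ x)
  exact congrArg Subtype.val (eigenBase_index_unique hinj hγ h1 h2)

/-- A nonzero component at another γ' would make γ' correspond to χ as well, against uniqueness. -/
theorem Corresponds.jointEigen_le (hinj : SteinitzTorsionFree e R)
    (hΔ : (Δ : Set (AutExt e k R)) = XSet e k R) (htor : IsSteinitzTorsion e Γ)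
    (h : IsGroupGrading 𝒜) {χ : PontryaginDual Δ} {γ : Γ} (hγ : Corresponds h χ γ) :
    jointEigen Δ χ ≤ 𝒜 γ := fun x hx => by
  have hD : ∀ σ ∈ Δ, IsMuDiagonalizable σ := fun σ hσ => by
    have : σ ∈ XSet e k R := hΔ ▸ hσ
    exact this.1
  have hzero : ∀ γ', γ' ≠ γ → internalProj h.isDirect γ' x = 0 := fun γ' hne => by
    by_contra h0
    exact hne ((corresponds_of_internalProj_ne_zero hinj hD h hx h0).unique hinj hΔ htor h hγ)
  have : x = internalProj h.isDirect γ x := by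
    rw [← sub_eq_zero]
    refine internal_eq_zero h.isDirect fun γ' => ?_
    rw [map_sub]
    by_cases hne : γ = γ'
    · subst hne
      rw [internalProj_of_mem h.isDirect (internalProj_mem h.isDirect γ x), sub_self]
    · rw [internalProj_of_mem_ne h.isDirect hne (internalProj_mem h.isDirect γ x), sub_zero,
        hzero γ' (Ne.symm hne)]
  rw [this]
  exact internalProj_mem h.isDirect γ x

/-- A nonzero joint eigenvector has a nonzero component, which settles the support. Correspondence
respects products and inverses, so generation by the support covers characters with zero eigenspace.
-/
theorem exists_corresponds (hinj : SteinitzTorsionFree e R)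
    (hΔ : (Δ : Set (AutExt e k R)) = XSet e k R) (hc : IsCompact (Δ : Set (AutExt e k R)))
    (hcomm : ∀ σ ∈ Δ, ∀ τ ∈ Δ, σ * τ = τ * σ) (h : IsGroupGrading 𝒜) (χ : PontryaginDual Δ) :
    ∃ γ, Corresponds h χ γ := by
  have hD : ∀ σ ∈ Δ, IsMuDiagonalizable σ := fun σ hσ => by
    have : σ ∈ XSet e k R := hΔ ▸ hσ
    exact this.1
  have hχ : χ ∈ Subgroup.closure {χ : PontryaginDual Δ | jointEigen Δ χ ≠ ⊥} := by
    rw [closure_support_jointEigen hinj hΔ hc hcomm]; trivial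
  refine Subgroup.closure_induction (p := fun χ _ => ∃ γ, Corresponds h χ γ) (fun χ hχ => ?_)
    ⟨1, fun ψ δ _ => by rw [map_one]; rfl⟩ ?_ ?_ hχ
  · obtain ⟨x, hx, h0⟩ := Submodule.exists_mem_ne_zero_of_ne_bot hχ
    obtain ⟨γ, hγ⟩ : ∃ γ, internalProj h.isDirect γ x ≠ 0 := by
      by_contra! hall
      exact h0 (internal_eq_zero h.isDirect hall)
    exact ⟨γ, corresponds_of_internalProj_ne_zero hinj hD h hx hγ⟩
  · rintro χ χ' _ _ ⟨γ, hγ⟩ ⟨γ', hγ'⟩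
    refine ⟨γ * γ', fun ψ δ hδ => ?_⟩
    rw [map_mul, Subgroup.coe_mul, ← hγ ψ δ hδ, ← hγ' ψ δ hδ]
    rfl
  · rintro χ _ ⟨γ, hγ⟩
    refine ⟨γ⁻¹, fun ψ δ hδ => ?_⟩
    rw [map_inv, Subgroup.coe_inv, ← hγ ψ δ hδ]
    rfl

theorem existsUnique_gradingMap_jointEigen (hinj : SteinitzTorsionFree e R)
    (hΔ : (Δ : Set (AutExt e k R)) = XSet e k R) (hc : IsCompact (Δ : Set (AutExt e k R)))
    (hcomm : ∀ σ ∈ Δ, ∀ τ ∈ Δ, σ * τ = τ * σ) (htor : IsSteinitzTorsion e Γ)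
    (h : IsGroupGrading 𝒜) :
    ∃! φ : PontryaginDual Δ →* Γ, gradingMap φ (fun χ => jointEigen Δ χ) = 𝒜 := by
  choose f hf using exists_corresponds (Δ := Δ) hinj hΔ hc hcomm h
  have hmul : ∀ χ χ', f (χ * χ') = f χ * f χ' := fun χ χ' => by
    refine (hf (χ * χ')).unique hinj hΔ htor h fun ψ δ hδ => ?_
    rw [map_mul, Subgroup.coe_mul, ← hf χ ψ δ hδ, ← hf χ' ψ δ hδ]
    rfl
  refine ⟨MonoidHom.mk' f hmul, ?_, fun φ hφ => ?_⟩
  · exact gradingMap_eq_of_le (isGroupGrading_jointEigen hinj hΔ hc hcomm) h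
      fun χ => (hf χ).jointEigen_le hinj hΔ htor h
  -- On the support, φ χ is forced, because a nonzero homogeneous element lies in only one component
  -- of 𝒜; the support generates.
  · refine MonoidHom.eq_of_eqOn_dense (closure_support_jointEigen hinj hΔ hc hcomm) ?_
    intro χ hχ
    obtain ⟨x, hx, h0⟩ := Submodule.exists_mem_ne_zero_of_ne_bot hχ
    have h1 : x ∈ 𝒜 (φ χ) := by
      rw [← hφ]
      exact le_gradingMap φ (fun χ => jointEigen Δ χ) χ hx
    exact internal_index_unique h.isDirect h0 h1 ((hf χ).jointEigen_le hinj hΔ htor h hx)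

end Universal

end Joint

/-! ### Assembly of the theorem -/

theorem isUniversalGrading_jointEigen {e : Steinitz} {k : Type s} [CommRing k] {R : Type r} [Ring R]
    [Algebra k R] (hinj : SteinitzTorsionFree e R) {Δ : Subgroup (AutExt e k R)}
    (hΔ : (Δ : Set (AutExt e k R)) = XSet e k R) (hc : IsCompact (Δ : Set (AutExt e k R)))
    (hcomm : ∀ σ ∈ Δ, ∀ τ ∈ Δ, σ * τ = τ * σ) :
    IsUniversalGrading.{w} e (fun χ : PontryaginDual Δ => jointEigen Δ χ) where
  grading := isGroupGrading_jointEigen hinj hΔ hc hcomm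
  torsion := isSteinitzTorsion_pontryaginDual (fun σ hσ => by
    have : σ ∈ XSet e k R := hΔ ▸ hσ
    exact this.1) hc
  initial := fun _ _ htor _ h => existsUnique_gradingMap_jointEigen hinj hΔ hc hcomm htor h

end

theorem mainTheorem9 (e : Steinitz) (k : Type s) [CommRing k] (R : Type r) [Ring R]
    [Algebra k R]
    (hinj : ∀ d : ℕ, StDvd d e → Function.Injective (fun x : R => d • x)) :
    ((∃ (Υ : Type r) (_ : CommGroup Υ) (𝒰 : Υ → Submodule k R),
        IsUniversalGrading.{w} e 𝒰) ↔
      ∃ Δ : Subgroup (AutExt e k R), (Δ : Set (AutExt e k R)) = XSet e k R ∧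
        IsCompact (Δ : Set (AutExt e k R)) ∧ ∀ σ ∈ Δ, ∀ τ ∈ Δ, σ * τ = τ * σ) ∧
    (∀ Δ : Subgroup (AutExt e k R), (Δ : Set (AutExt e k R)) = XSet e k R →
      IsCompact (Δ : Set (AutExt e k R)) → (∀ σ ∈ Δ, ∀ τ ∈ Δ, σ * τ = τ * σ) →
      (∀ (χ : PontryaginDual Δ) (δ : Δ), χ δ ∈ mu e) ∧
      IsUniversalGrading.{w} e (fun χ : PontryaginDual Δ => jointEigen Δ χ)) := by
  refine ⟨⟨?_, ?_⟩, fun Δ hΔ hc hcomm => ⟨fun χ δ => ?_, ?_⟩⟩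
  · rintro ⟨Υ, _, 𝒰, h⟩
    exact exists_compact_of_universal hinj h
  · rintro ⟨Δ, hΔ, hc, hcomm⟩
    exact ⟨PontryaginDual Δ, inferInstance, _, isUniversalGrading_jointEigen hinj hΔ hc hcomm⟩
  · refine character_mem_mu (fun σ hσ => ?_) χ δ
    have : σ ∈ XSet e k R := hΔ ▸ hσ
    exact this.1
  · exact isUniversalGrading_jointEigen hinj hΔ hc hcomm
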